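/- Let $K_v$ be the complete graph on $v$ vertices. A Hamiltonian cycle system of order $v$ (HCS$(v)$) is a set of Hamiltonian cycles of $K_v$ whose edges partition the edge set of $K_v$. Its full automorphism group is the group of all permutations of the vertices of $K_v$ that map the set of cycles onto itself. Theorem. For every integer $d \ge 3$ there exists an HCS$(8d+1)$ whose full automorphism group is isomorphic to the quaternion group $\mathbb{Q}_8$ of order $8$. -/

import Mathlib

/-- A set `C` of unordered pairs of `V` is (the edge set of) a Hamiltonian cycle of the complete
graph on `V`. Cycles are identified with their edge sets, so that the starting vertex and the
direction in which a cycle is traversed do not matter. -/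
def IsHamCycle {V : Type*} [DecidableEq V] (C : Set (Sym2 V)) : Prop :=
  ∃ (u : V) (p : (⊤ : SimpleGraph V).Walk u u), p.IsHamiltonianCycle ∧ C = {e | e ∈ p.edges}

/-- A Hamiltonian cycle system on the vertex set `V`: a set of Hamiltonian cycles of the complete
graph on `V` whose edges partition the edge set of the complete graph. -/
structure HamCycleSystem (V : Type*) [DecidableEq V] where
  /-- the cycles of the system, given by their edge sets -/
  cycles : Set (Set (Sym2 V))
  isHamCycle : ∀ C ∈ cycles, IsHamCycle C
  existsUnique_mem : ∀ e ∈ (⊤ : SimpleGraph V).edgeSet, ∃! C, C ∈ cycles ∧ e ∈ C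

/-- The image of a set of unordered pairs under a permutation of the vertices. -/
def permuteEdges {V : Type*} (σ : Equiv.Perm V) (C : Set (Sym2 V)) : Set (Sym2 V) :=
  Sym2.map σ '' C

theorem permuteEdges_one {V : Type*} : permuteEdges (1 : Equiv.Perm V) = id := by
  funext C
  simp [permuteEdges]

theorem permuteEdges_mul {V : Type*} (σ τ : Equiv.Perm V) :
    permuteEdges (σ * τ) = permuteEdges σ ∘ permuteEdges τ := by
  funext C
  simp [permuteEdges, Set.image_image, Sym2.map_map]

/-- The full automorphism group of a Hamiltonian cycle system: the group of all permutations of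
the vertices that map its set of cycles onto itself. -/
def HamCycleSystem.autGroup {V : Type*} [DecidableEq V] (𝓗 : HamCycleSystem V) :
    Subgroup (Equiv.Perm V) where
  carrier := {σ | permuteEdges σ '' 𝓗.cycles = 𝓗.cycles}
  one_mem' := by
    simp [permuteEdges_one]
  mul_mem' := by
    intro σ τ hσ hτ
    simp only [Set.mem_ofPred_eq] at hσ hτ ⊢
    rw [permuteEdges_mul, Set.image_comp, hτ, hσ]
  inv_mem' := by
    intro σ hσ
    simp only [Set.mem_ofPred_eq] at hσ ⊢
    conv_lhs => rw [← hσ]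
    rw [← Set.image_comp, ← permuteEdges_mul, inv_mul_cancel, permuteEdges_one, Set.image_id]

/-! The vertices are a point ∞ and d blocks, copies of the quaternion group indexed by `ZMod d`; the
group fixes ∞ and acts on each block by left multiplication. For each u a path of 4d vertices meets
every coset of the centre {1, z} in every block once. The path, its image under z and ∞ form a
Hamiltonian cycle that z reflects, so a translate depends only on the class of t modulo the centre.
With four classes and d base cycles this gives 4d(8d + 1) edges, exactly as many as the complete
graph has; disjointness therefore follows once every edge is covered.

Path u runs four times (there, back, there, back) along a zigzag through the blocks, with an extra
vertex at the start and at the first turn. Two blocks are consecutive in two zigzags, once for each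
`kind`, and these 2 · 4 steps must realise all eight quotients. Values are first chosen modulo the
centre, in the Klein group. Where the four differences in both gaps are distinct, the two gaps
simply take opposite lifts. In the first and last gap this is impossible: the strand values sum to 0
in an inner block but to some y ≠ 0 in an end block, so one difference is missing and another,
differing from it by y, is repeated. Taking y from a proper 3-colouring of the edges {i, i + 1}
gives both gaps over such an edge the same y; one gap repeats 0 and lacks y, the other does the
opposite, and a repeated difference receives both lifts (`exists_gapLift_eq`).

For the automorphisms: if one moved ∞, composing z with its conjugate would rotate every cycle and
act transitively on the vertices, which the pairs at distance two rule out
(`sameCycle_of_map_infty_ne`, `not_sameCycle_turn`). Base cycle 0 alone has its repeated first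
difference on strand 0, and an edge pattern detects this (`sameCycle_start`, `not_sameCycle_start`).
An automorphism therefore maps base cycle 0, position by position, to one of its translates, and so
is a group element. -/

/-! ### Hamiltonian cycles as cyclic sequences -/

/-- The edges of the closed walk `c 0, c 1, …, c (n - 1), c 0`. -/
def cyclicEdges {V : Type*} {n : ℕ} (c : ZMod n → V) : Set (Sym2 V) :=
  Set.range fun k => s(c k, c (k + 1))

theorem mk_mem_cyclicEdges {V : Type*} {n : ℕ} (c : ZMod n → V) (k : ZMod n) :
    s(c k, c (k + 1)) ∈ cyclicEdges c :=
  ⟨k, rfl⟩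

theorem permuteEdges_cyclicEdges {V : Type*} {n : ℕ} (σ : Equiv.Perm V) (c : ZMod n → V) :
    permuteEdges σ (cyclicEdges c) = cyclicEdges (σ ∘ c) := by
  rw [permuteEdges, cyclicEdges, ← Set.range_comp]
  rfl

theorem cyclicEdges_comp_neg {V : Type*} {n : ℕ} (c : ZMod n → V) :
    cyclicEdges (fun k => c (-k)) = cyclicEdges c := by
  ext e
  constructor
  · rintro ⟨k, rfl⟩
    refine ⟨-(k + 1), ?_⟩
    simp only [neg_add_rev, neg_add_cancel_comm, Sym2.eq_swap]
  · rintro ⟨k, rfl⟩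
    refine ⟨-(k + 1), ?_⟩
    simp [Sym2.eq_swap]

theorem isHamCycle_cyclicEdges {V : Type*} [DecidableEq V] {n : ℕ} (hn : 3 ≤ n)
    (c : ZMod n → V) (hc : Function.Bijective c) : IsHamCycle (cyclicEdges c) := by
  obtain ⟨m, rfl⟩ : ∃ m, n = m + 3 := ⟨n - 3, by omega⟩
  let f : SimpleGraph.cycleGraph (m + 3) →g (⊤ : SimpleGraph V) :=
    ⟨c, fun {a b} h => fun hab => h.ne (hc.1 hab)⟩
  have hf : Function.Bijective f := hc
  have hcyc : (SimpleGraph.cycleGraph.cycle m).IsHamiltonianCycle :=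
    SimpleGraph.Walk.isHamiltonianCycle_iff_isCycle_and_length_eq.2
      ⟨SimpleGraph.cycleGraph.isCycle_cycle, by simp⟩
  -- The cycle of the cycle graph runs through its vertices in decreasing order, which accounts for
  -- the signs below.
  have hvert : ∀ i ≤ m + 3, (SimpleGraph.cycleGraph.cycle m).getVert i =
      -((i : ℕ) : ZMod (m + 3)) := by
    intro i hi
    rw [SimpleGraph.cycleGraph.getVert_cycle hi]
    have h1 : (((m + 3 - i : ℕ) : ZMod (m + 3))) = -((i : ℕ) : ZMod (m + 3)) := by
      rw [Nat.cast_sub hi, ZMod.natCast_self, zero_sub]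
    rw [← h1]
    refine (ZMod.val_injective (m + 3) ?_ :)
    rw [ZMod.val_natCast]
    rfl
  refine ⟨c 0, (SimpleGraph.cycleGraph.cycle m).map f, hcyc.map hf, ?_⟩
  ext e
  simp only [SimpleGraph.Walk.edges_map, List.mem_map, Set.mem_ofPred_eq]
  constructor
  · rintro ⟨k, rfl⟩
    refine ⟨(s(k, k + 1) : Sym2 (ZMod (m + 3))), ?_, rfl⟩
    refine (SimpleGraph.Walk.mk_mem_edges_iff_exists _).2 ⟨(-(k + 1)).val, ?_, ?_⟩
    · rw [SimpleGraph.cycleGraph.length_cycle]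
      exact ZMod.val_lt _
    · have hlt := ZMod.val_lt (-(k + 1))
      have h1 := hvert _ hlt.le
      have h2 := hvert _ hlt
      rw [ZMod.natCast_zmod_val, neg_neg] at h1
      rw [Nat.succ_eq_add_one, Nat.cast_add, ZMod.natCast_zmod_val, Nat.cast_one,
        show -(-(k + 1) + 1) = k by ring] at h2
      rw [h1, h2]
      exact Sym2.eq_swap
  · rintro ⟨e, he, rfl⟩
    obtain ⟨i, hi, rfl⟩ : ∃ i, i < m + 3 ∧ s(-((i : ℕ) : ZMod (m + 3)),
        -((i + 1 : ℕ) : ZMod (m + 3))) = e := by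
      induction e using Sym2.ind with
      | _ x y =>
        obtain ⟨i, hi, h⟩ := (SimpleGraph.Walk.mk_mem_edges_iff_exists _).1 he
        rw [SimpleGraph.cycleGraph.length_cycle] at hi
        rw [hvert i hi.le, hvert (i + 1) hi] at h
        exact ⟨i, hi, h⟩
    refine ⟨-((i + 1 : ℕ) : ZMod (m + 3)), ?_⟩
    rw [Sym2.eq_swap]
    simp only [Nat.cast_add, Nat.cast_one, neg_add_rev, neg_add_cancel_comm]
    rfl

theorem two_ne_zero_of_three_le {n : ℕ} (hn : 3 ≤ n) : (2 : ZMod n) ≠ 0 := by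
  have : ((2 : ℕ) : ZMod n) ≠ 0 := by
    rw [Ne, ZMod.natCast_eq_zero_iff]
    exact fun h => absurd (Nat.le_of_dvd (by norm_num) h) (by omega)
  exact_mod_cast this

/-- An injective self-map of the cycle graph that maps edges to edges is a rotation or a
reflection. -/
theorem eq_add_or_eq_sub_of_step {n : ℕ} (hn : 3 ≤ n) (τ : ZMod n → ZMod n)
    (hτ : Function.Injective τ) (h : ∀ k, τ (k + 1) = τ k + 1 ∨ τ (k + 1) = τ k - 1) :
    (∀ k, τ k = τ 0 + k) ∨ (∀ k, τ k = τ 0 - k) := by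
  have : NeZero n := ⟨by omega⟩
  have h2 := two_ne_zero_of_three_le hn
  have key : ∀ k, τ (k + 1 + 1) ≠ τ k := fun k hk => h2 (by
    have := hτ hk
    linear_combination this)
  rcases h 0 with h0 | h0
  · left
    have hs : ∀ j : ℕ, τ (j + 1) = τ j + 1 := by
      intro j
      induction j with
      | zero => rwa [Nat.cast_zero]
      | succ j ih =>
        rcases h ((j : ZMod n) + 1) with h1 | h1
        · rwa [Nat.cast_succ]
        · exact absurd (by rw [h1, ih]; ring) (key j)
    have ht : ∀ j : ℕ, τ j = τ 0 + j := by
      intro j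
      induction j with
      | zero => rw [Nat.cast_zero, add_zero]
      | succ j ih => rw [Nat.cast_succ, hs, ih]; ring
    intro k
    have hk := ht k.val
    rwa [ZMod.natCast_zmod_val] at hk
  · right
    have hs : ∀ j : ℕ, τ (j + 1) = τ j - 1 := by
      intro j
      induction j with
      | zero => rwa [Nat.cast_zero]
      | succ j ih =>
        rcases h ((j : ZMod n) + 1) with h1 | h1
        · exact absurd (by rw [h1, ih]; ring) (key j)
        · rwa [Nat.cast_succ]
    have ht : ∀ j : ℕ, τ j = τ 0 - j := by
      intro j
      induction j with
      | zero => rw [Nat.cast_zero, sub_zero]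
      | succ j ih => rw [Nat.cast_succ, hs, ih]; ring
    intro k
    have hk := ht k.val
    rwa [ZMod.natCast_zmod_val] at hk

/-- The map `c'⁻¹ ∘ c` sends neighbours in `ZMod n` to neighbours, so it is a rotation or a
reflection. -/
theorem exists_shift_of_cyclicEdges_eq {V : Type*} {n : ℕ} (hn : 3 ≤ n) {c c' : ZMod n → V}
    (hc : Function.Bijective c) (hc' : Function.Bijective c')
    (h : cyclicEdges c = cyclicEdges c') :
    ∃ b, (∀ k, c k = c' (b + k)) ∨ (∀ k, c k = c' (b - k)) := by
  let e := Equiv.ofBijective c' hc'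
  obtain ⟨τ, hτe⟩ : ∃ τ : ZMod n → ZMod n, τ = fun k => e.symm (c k) := ⟨_, rfl⟩
  have hτc : ∀ k, c' (τ k) = c k := fun k => by
    rw [hτe]
    exact e.apply_symm_apply (c k)
  have hτ : Function.Injective τ := hτe ▸ e.symm.injective.comp hc.1
  have hstep : ∀ k, τ (k + 1) = τ k + 1 ∨ τ (k + 1) = τ k - 1 := by
    intro k
    obtain ⟨l, hl⟩ : s(c k, c (k + 1)) ∈ cyclicEdges c' := h ▸ mk_mem_cyclicEdges c k
    have hl' : s(c' l, c' (l + 1)) = s(c' (τ k), c' (τ (k + 1))) := by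
      rw [hτc, hτc]
      exact hl
    rcases Sym2.eq_iff.1 hl' with ⟨h1, h2⟩ | ⟨h1, h2⟩
    · left
      rw [← hc'.1 h1, ← hc'.1 h2]
    · right
      rw [← hc'.1 h1, ← hc'.1 h2]
      ring
  refine ⟨τ 0, ?_⟩
  rcases eq_add_or_eq_sub_of_step hn τ hτ hstep with h1 | h1
  · exact Or.inl fun k => by rw [← h1 k, hτc]
  · exact Or.inr fun k => by rw [← h1 k, hτc]

/-! ### Systems of translates and their automorphisms -/

/-- Base cycles for a Hamiltonian cycle system on `V` that is invariant under a group `Q` fixing a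
vertex and that has a central involution `z` acting on every cycle as a reflection. -/
structure CycleStarter (Q V ι : Type*) [Group Q] [MulAction Q V] (n : ℕ) where
  base : ι → ZMod n → V
  infty : V
  z : Q
  base_bijective : ∀ u, Function.Bijective (base u)
  base_zero : ∀ u, base u 0 = infty
  smul_infty : ∀ t : Q, t • infty = infty
  mul_z : ∀ t : Q, t * z = z * t
  base_neg : ∀ u k, base u (-k) = z • base u k
  exists_mem : ∀ x y, x ≠ y → ∃ (t : Q) (u : ι), s(x, y) ∈ cyclicEdges fun k => t • base u k
  eq_of_mem : ∀ (t t' : Q) (u u' : ι) (e : Sym2 V),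
    (e ∈ cyclicEdges fun k => t • base u k) → (e ∈ cyclicEdges fun k => t' • base u' k) →
    u = u' ∧ (cyclicEdges fun k => t • base u k) = cyclicEdges fun k => t' • base u' k

namespace CycleStarter

variable {Q V ι : Type*} [Group Q] [MulAction Q V] {n : ℕ} (S : CycleStarter Q V ι n)

/-- A translate of a base cycle. -/
def cyc (t : Q) (u : ι) (k : ZMod n) : V := t • S.base u k

theorem cyc_bijective (t : Q) (u : ι) : Function.Bijective (S.cyc t u) :=
  (MulAction.bijective t).comp (S.base_bijective u)

theorem cyc_zero (t : Q) (u : ι) : S.cyc t u 0 = S.infty := by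
  rw [cyc, S.base_zero, S.smul_infty]

theorem smul_cyc (t t' : Q) (u : ι) (k : ZMod n) : t • S.cyc t' u k = S.cyc (t * t') u k :=
  smul_smul t t' _

theorem z_smul_cyc (t : Q) (u : ι) (k : ZMod n) : S.z • S.cyc t u k = S.cyc t u (-k) := by
  rw [cyc, cyc, S.base_neg, smul_smul, smul_smul, S.mul_z]

/-- The Hamiltonian cycle system formed by the translates of the base cycles. -/
def system [DecidableEq V] (hn : 3 ≤ n) : HamCycleSystem V where
  cycles := {C | ∃ t u, C = cyclicEdges (S.cyc t u)}
  isHamCycle := by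
    rintro C ⟨t, u, rfl⟩
    exact isHamCycle_cyclicEdges hn _ (S.cyc_bijective t u)
  existsUnique_mem := by
    intro e he
    induction e using Sym2.ind with
    | _ x y =>
      obtain ⟨t, u, h⟩ := S.exists_mem x y (by simpa using he)
      refine ⟨_, ⟨⟨t, u, rfl⟩, h⟩, ?_⟩
      rintro _ ⟨⟨t', u', rfl⟩, h'⟩
      exact (S.eq_of_mem _ _ _ _ _ h' h).2

/-- Two pairs of vertices are edges of a common cycle of the system. -/
def SameCycle (e e' : Sym2 V) : Prop :=
  ∃ t u, e ∈ cyclicEdges (S.cyc t u) ∧ e' ∈ cyclicEdges (S.cyc t u)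

variable [DecidableEq V] {hn : 3 ≤ n} {σ : Equiv.Perm V}

theorem exists_cyclicEdges_of_mem_autGroup (hσ : σ ∈ (S.system hn).autGroup) (t : Q) (u : ι) :
    ∃ t' u', cyclicEdges (σ ∘ S.cyc t u) = cyclicEdges (S.cyc t' u') := by
  have h : permuteEdges σ (cyclicEdges (S.cyc t u)) ∈ (S.system hn).cycles := by
    have h' : permuteEdges σ '' (S.system hn).cycles = (S.system hn).cycles := hσ
    rw [← h']
    exact ⟨_, ⟨t, u, rfl⟩, rfl⟩
  rw [permuteEdges_cyclicEdges] at h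
  exact h

theorem exists_shift_of_mem_autGroup (hσ : σ ∈ (S.system hn).autGroup) (t : Q) (u : ι) :
    ∃ t' u' b, (∀ k, σ (S.cyc t u k) = S.cyc t' u' (b + k)) ∨
      (∀ k, σ (S.cyc t u k) = S.cyc t' u' (b - k)) := by
  obtain ⟨t', u', h⟩ := S.exists_cyclicEdges_of_mem_autGroup hσ t u
  obtain ⟨b, hb⟩ := exists_shift_of_cyclicEdges_eq hn (σ.bijective.comp (S.cyc_bijective t u))
    (S.cyc_bijective t' u') h
  exact ⟨t', u', b, hb⟩

theorem sameCycle_map (hσ : σ ∈ (S.system hn).autGroup) {e e' : Sym2 V} (h : S.SameCycle e e') :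
    S.SameCycle (e.map σ) (e'.map σ) := by
  obtain ⟨t, u, h1, h2⟩ := h
  obtain ⟨t', u', ht⟩ := S.exists_cyclicEdges_of_mem_autGroup hσ t u
  rw [← permuteEdges_cyclicEdges] at ht
  exact ⟨t', u', ht ▸ Set.mem_image_of_mem _ h1, ht ▸ Set.mem_image_of_mem _ h2⟩

/-- Position 0 is always ∞, so the shift is trivial; a reflection is absorbed into the translating
element by z. -/
theorem exists_cyc_of_map_infty (hσ : σ ∈ (S.system hn).autGroup) (h : σ S.infty = S.infty)
    (t : Q) (u : ι) : ∃ t' u', ∀ k, σ (S.cyc t u k) = S.cyc t' u' k := by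
  obtain ⟨t', u', b, hb⟩ := S.exists_shift_of_mem_autGroup hσ t u
  have hb0 : b = 0 := by
    apply (S.cyc_bijective t' u').1
    rw [S.cyc_zero]
    rcases hb with hb | hb
    · rw [← add_zero b, ← hb, S.cyc_zero, h]
    · rw [← sub_zero b, ← hb, S.cyc_zero, h]
  subst hb0
  rcases hb with hb | hb
  · exact ⟨t', u', fun k => by rw [hb, zero_add]⟩
  · exact ⟨S.z * t', u', fun k => by rw [hb, zero_sub, ← S.z_smul_cyc, S.smul_cyc]⟩

/-- If an automorphism moves the fixed vertex of `Q`, then the system is cyclic. -/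
theorem sameCycle_of_map_infty_ne (hodd : Odd n) (hσ : σ ∈ (S.system hn).autGroup)
    (h : σ S.infty ≠ S.infty) (t : Q) (u : ι) (l : ZMod n) :
    S.SameCycle s(S.cyc t u (-1), S.cyc t u 1) s(S.cyc t u (l - 1), S.cyc t u (l + 1)) := by
  have : NeZero n := ⟨by omega⟩
  have : Fact (1 < n) := ⟨by omega⟩
  -- z reflects every cycle about ∞, and its conjugate by σ reflects every cycle about σ ∞. Their
  -- product ρ rotates each cycle by twice the position of σ ∞.
  obtain ⟨ρ, hρ⟩ : ∃ ρ : V → V, ρ = fun v => σ (S.z • σ.symm (S.z • v)) := ⟨_, rfl⟩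
  have hrot : ∀ t u, ∃ b, S.cyc t u b = σ S.infty ∧
      ∀ k, ρ (S.cyc t u k) = S.cyc t u (2 * b + k) := by
    intro t u
    obtain ⟨t', u', b', hb'⟩ := S.exists_shift_of_mem_autGroup (inv_mem hσ) t u
    have hb : ∃ b, (∀ k, σ (S.cyc t' u' k) = S.cyc t u (b + k)) ∨
        (∀ k, σ (S.cyc t' u' k) = S.cyc t u (b - k)) := by
      rcases hb' with hb' | hb'
      · refine ⟨-b', Or.inl fun k => ?_⟩
        rw [← Equiv.Perm.eq_inv_iff_eq, hb']
        ring_nf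
      · refine ⟨b', Or.inr fun k => ?_⟩
        rw [← Equiv.Perm.eq_inv_iff_eq, hb']
        ring_nf
    obtain ⟨b, hb⟩ := hb
    refine ⟨b, ?_, fun k => ?_⟩
    · rw [← S.cyc_zero t' u']
      rcases hb with hb | hb
      · rw [hb, add_zero]
      · rw [hb, sub_zero]
    · rw [hρ]
      simp only [S.z_smul_cyc]
      rcases hb with hb | hb
      · have h1 : S.cyc t u (-k) = σ (S.cyc t' u' (-k - b)) := by rw [hb]; ring_nf
        rw [h1, Equiv.symm_apply_apply, S.z_smul_cyc, hb]
        ring_nf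
      · have h1 : S.cyc t u (-k) = σ (S.cyc t' u' (k + b)) := by rw [hb]; ring_nf
        rw [h1, Equiv.symm_apply_apply, S.z_smul_cyc, hb]
        ring_nf
  have hiter : ∀ t u b, (∀ k, ρ (S.cyc t u k) = S.cyc t u (2 * b + k)) → ∀ (j : ℕ) k,
      ρ^[j] (S.cyc t u k) = S.cyc t u (j * (2 * b) + k) := by
    intro t u b hb j
    induction j with
    | zero => simp
    | succ j ih =>
      intro k
      rw [Function.iterate_succ_apply, hb, ih]
      push_cast
      ring_nf
  have hpres : ∀ t u (j : ℕ) x y, s(x, y) ∈ cyclicEdges (S.cyc t u) →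
      s(ρ^[j] x, ρ^[j] y) ∈ cyclicEdges (S.cyc t u) := by
    rintro t u j x y ⟨k, hk⟩
    obtain ⟨b, -, hb⟩ := hrot t u
    refine ⟨j * (2 * b) + k, ?_⟩
    have hm := congrArg (Sym2.map ρ^[j]) hk
    simp only [Sym2.map_mk, hiter t u b hb] at hm
    rw [← hm]
    simp only [add_assoc]
  obtain ⟨b, hbw, hb⟩ := hrot t u
  have hb0 : b ≠ 0 := fun h0 => h (by rw [← hbw, h0, S.cyc_zero])
  have h2b : 2 * b ≠ 0 := by
    intro h0
    apply hb0
    have hu : IsUnit (2 : ZMod n) := by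
      have h2 : IsUnit ((2 : ℕ) : ZMod n) :=
        (ZMod.isUnit_iff_coprime 2 n).2 (Nat.coprime_two_left.2 hodd)
      exact_mod_cast h2
    exact (hu.mul_right_eq_zero).1 h0
  have hne : S.infty ≠ ρ S.infty := by
    intro h0
    rw [← S.cyc_zero t u, hb, add_zero] at h0
    exact h2b ((S.cyc_bijective t u).1 h0).symm
  -- On the cycle containing the edge from ∞ to ρ ∞ the rotation is by ±1, so the powers of ρ move ∞
  -- to every vertex.
  obtain ⟨t₀, u₀, k, hk⟩ := S.exists_mem _ _ hne
  replace hk : s(S.cyc t₀ u₀ k, S.cyc t₀ u₀ (k + 1)) = s(S.infty, ρ S.infty) := hk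
  obtain ⟨b₀, -, hb₀⟩ := hrot t₀ u₀
  have hstep : 2 * b₀ = 1 ∨ 2 * b₀ = -1 := by
    rw [← S.cyc_zero t₀ u₀, hb₀, add_zero] at hk
    rcases Sym2.eq_iff.1 hk with ⟨h1, h2⟩ | ⟨h1, h2⟩
    · left
      rw [← (S.cyc_bijective t₀ u₀).1 h2, (S.cyc_bijective t₀ u₀).1 h1, zero_add]
    · right
      rw [← (S.cyc_bijective t₀ u₀).1 h1]
      linear_combination (S.cyc_bijective t₀ u₀).1 h2
  have htrans : ∀ v, ∃ j : ℕ, ρ^[j] S.infty = v := by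
    intro v
    obtain ⟨m, rfl⟩ := (S.cyc_bijective t₀ u₀).2 v
    rw [← S.cyc_zero t₀ u₀]
    rcases hstep with h1 | h1
    · refine ⟨m.val, ?_⟩
      rw [hiter _ _ _ hb₀, h1, ZMod.natCast_zmod_val, mul_one, add_zero]
    · refine ⟨(-m).val, ?_⟩
      rw [hiter _ _ _ hb₀, h1, ZMod.natCast_zmod_val]
      ring_nf
  obtain ⟨j, hj⟩ := htrans (S.cyc t u l)
  rw [← S.cyc_zero t u, hiter _ _ _ hb, add_zero] at hj
  have hjl := (S.cyc_bijective t u).1 hj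
  have hd : S.cyc t u (-1) ≠ S.cyc t u 1 := by
    intro h0
    apply two_ne_zero_of_three_le hn
    linear_combination -(S.cyc_bijective t u).1 h0
  obtain ⟨t₁, u₁, h₁⟩ := S.exists_mem _ _ hd
  refine ⟨t₁, u₁, h₁, ?_⟩
  have h2 := hpres t₁ u₁ j _ _ h₁
  rw [hiter _ _ _ hb, hiter _ _ _ hb, hjl, ← sub_eq_add_neg] at h2
  exact h2

theorem toPerm_mem_autGroup (t : Q) : MulAction.toPerm t ∈ (S.system hn).autGroup := by
  have key : ∀ t : Q, ∀ C ∈ (S.system hn).cycles,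
      permuteEdges (MulAction.toPerm t) C ∈ (S.system hn).cycles := by
    rintro t _ ⟨t', u, rfl⟩
    refine ⟨t * t', u, ?_⟩
    rw [permuteEdges_cyclicEdges]
    congr 1
    funext k
    exact S.smul_cyc t t' u k
  apply Set.Subset.antisymm
  · rintro _ ⟨C, hC, rfl⟩
    exact key t C hC
  · intro C hC
    refine ⟨_, key t⁻¹ C hC, ?_⟩
    have : (permuteEdges (MulAction.toPerm t) ∘ permuteEdges (MulAction.toPerm t⁻¹)) C = C := by
      rw [← permuteEdges_mul]
      have h1 : (MulAction.toPerm t * MulAction.toPerm t⁻¹ : Equiv.Perm V) = 1 := by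
        ext v
        simp
      rw [h1, permuteEdges_one]
      rfl
    exact this

/-- A pattern of edges that occurs only in the translates of one base cycle, together with a cycle
whose pairs of vertices at distance two are spread over several cycles, force the full
automorphism group to be `Q`. -/
theorem nonempty_autGroup_mulEquiv [FaithfulSMul Q V] (hn : 3 ≤ n) (hodd : Odd n) (u₀ : ι)
    (hspecial : ∀ u, S.SameCycle s(S.base u 1, S.base u (-1)) s(S.base u 2, S.base u (-3)) ↔
      u = u₀)
    (hspread : ∃ u l, ¬ S.SameCycle s(S.base u (-1), S.base u 1)
      s(S.base u (l - 1), S.base u (l + 1))) :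
    Nonempty ((S.system hn).autGroup ≃* Q) := by
  let f : Q →* (S.system hn).autGroup :=
    (MulAction.toPermHom Q V).codRestrict _ fun t => S.toPerm_mem_autGroup t
  have hone : ∀ u k, S.cyc 1 u k = S.base u k := fun u k => one_smul Q _
  have hf : Function.Bijective f := by
    constructor
    · intro t t' h
      exact MulAction.toPerm_injective (congrArg Subtype.val h)
    · rintro ⟨σ, hσ⟩
      have hinf : σ S.infty = S.infty := by
        by_contra hne
        obtain ⟨u, l, h⟩ := hspread
        apply h
        have := S.sameCycle_of_map_infty_ne hodd hσ hne 1 u l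
        simpa only [hone] using this
      -- Undoing t sends base cycle `u₀` to base cycle `u` position by position. The pattern is
      -- carried along, so `u = u₀`; the cycle visits every vertex, so σ acts as t.
      obtain ⟨t, u, ht⟩ := S.exists_cyc_of_map_infty hσ hinf 1 u₀
      have hτ : MulAction.toPerm t⁻¹ * σ ∈ (S.system hn).autGroup :=
        mul_mem (S.toPerm_mem_autGroup t⁻¹) hσ
      have hbase : ∀ k, (MulAction.toPerm t⁻¹ * σ : Equiv.Perm V) (S.base u₀ k) =
          S.base u k := by
        intro k
        rw [Equiv.Perm.mul_apply, ← hone, ht, MulAction.toPerm_apply, S.smul_cyc,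
          inv_mul_cancel, hone]
      have hu : u = u₀ := by
        rw [← hspecial]
        have := S.sameCycle_map hτ ((hspecial u₀).2 rfl)
        simpa only [Sym2.map_mk, hbase] using this
      subst hu
      refine ⟨t, Subtype.ext (Equiv.ext fun v => ?_)⟩
      obtain ⟨k, rfl⟩ := (S.base_bijective u).2 v
      have h1 := ht k
      rw [hone] at h1
      exact h1.symm
  exact ⟨(MulEquiv.ofBijective f hf).symm⟩

end CycleStarter

/-! ### Transport to another vertex set -/

/-- Transport of a Hamiltonian cycle system along a bijection of the vertex sets. -/
def HamCycleSystem.map {V W : Type*} [DecidableEq V] [DecidableEq W] (e : V ≃ W)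
    (𝓗 : HamCycleSystem V) : HamCycleSystem W where
  cycles := Set.image (Sym2.map e) '' 𝓗.cycles
  isHamCycle := by
    rintro _ ⟨C, hC, rfl⟩
    obtain ⟨u, p, hp, rfl⟩ := 𝓗.isHamCycle C hC
    let f : (⊤ : SimpleGraph V) →g (⊤ : SimpleGraph W) :=
      ⟨e, fun {a b} h => fun hab => h.ne (e.injective hab)⟩
    refine ⟨e u, p.map f, hp.map e.bijective, ?_⟩
    ext x
    simp only [SimpleGraph.Walk.edges_map, List.mem_map]
    rfl
  existsUnique_mem := by
    intro x hx
    have hx' : x.map e.symm ∈ (⊤ : SimpleGraph V).edgeSet := by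
      induction x using Sym2.ind with
      | _ a b => simpa using hx
    have hxe : (x.map e.symm).map e = x := by
      rw [Sym2.map_map]
      simp
    obtain ⟨C, ⟨hC, hxC⟩, huniq⟩ := 𝓗.existsUnique_mem _ hx'
    refine ⟨_, ⟨⟨C, hC, rfl⟩, ⟨_, hxC, hxe⟩⟩, ?_⟩
    rintro _ ⟨⟨C', hC', rfl⟩, ⟨y, hy, rfl⟩⟩
    rw [huniq C' ⟨hC', ?_⟩]
    rw [Sym2.map_map]
    simpa using hy

theorem HamCycleSystem.nonempty_autGroup_map {V W : Type*} [DecidableEq V] [DecidableEq W]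
    (e : V ≃ W) (𝓗 : HamCycleSystem V) : Nonempty ((𝓗.map e).autGroup ≃* 𝓗.autGroup) := by
  have hmap : 𝓗.autGroup.map e.permCongrHom.toMonoidHom = (𝓗.map e).autGroup := by
    have hconj : ∀ σ : Equiv.Perm V, permuteEdges (e.permCongr σ) ∘ Set.image (Sym2.map e) =
        Set.image (Sym2.map e) ∘ permuteEdges σ := by
      intro σ
      funext C
      simp only [permuteEdges, Function.comp_apply, Set.image_image, Sym2.map_map]
      congr 1
      funext x
      congr 1
      funext v
      simp
    have hinj : Function.Injective (Set.image (Set.image (Sym2.map e))) :=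
      Set.image_injective.2 (Set.image_injective.2 (Sym2.map.injective e.injective))
    have hiff : ∀ σ : Equiv.Perm V, e.permCongr σ ∈ (𝓗.map e).autGroup ↔ σ ∈ 𝓗.autGroup := by
      intro σ
      change permuteEdges (e.permCongr σ) '' (Set.image (Sym2.map e) '' 𝓗.cycles) =
        Set.image (Sym2.map e) '' 𝓗.cycles ↔ permuteEdges σ '' 𝓗.cycles = 𝓗.cycles
      rw [← Set.image_comp, hconj, Set.image_comp]
      exact hinj.eq_iff
    ext τ
    constructor
    · rintro ⟨σ, hσ, rfl⟩
      exact (hiff σ).2 hσ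
    · intro hτ
      obtain ⟨σ, rfl⟩ := e.permCongr.surjective τ
      exact ⟨σ, (hiff σ).1 hτ, rfl⟩
  rw [← hmap]
  exact ⟨(e.permCongrHom.subgroupMap 𝓗.autGroup).symm⟩

/-! ### Lifting differences from the Klein group to the quaternion group -/

/-- The Klein four-group, as the quotient of the quaternion group by its centre. -/
abbrev Klein := ZMod 2 × ZMod 2

/-- The quaternion group of order 8. -/
abbrev Quat := QuaternionGroup 2

/-- The projection of the quaternion group onto its central quotient. -/
def Quat.proj : Quat → Klein
  | .a i => (i.val, 0)
  | .xa i => (i.val, 1)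

/-- A section of `Quat.proj`. -/
def Klein.lift (b : Klein) : Quat :=
  if b.2 = 0 then .a b.1.val else .xa b.1.val

/-- The central involution of the quaternion group. -/
def Quat.z : Quat := .a 2

namespace Quat

theorem proj_mul : ∀ g h : Quat, proj (g * h) = proj g + proj h := by decide

theorem proj_inv : ∀ g : Quat, proj g⁻¹ = proj g := by decide

theorem proj_lift : ∀ b : Klein, proj b.lift = b := by decide

theorem mul_z : ∀ t : Quat, t * z = z * t := by decide

theorem z_mul_z : z * z = 1 := by decide

theorem proj_z : proj z = 0 := by decide

theorem proj_one : proj 1 = 0 := by decide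

theorem eq_or_eq_mul_z : ∀ g h : Quat, proj g = proj h → g = h ∨ g = h * z := by decide

end Quat

namespace Klein

theorem add_self : ∀ a : Klein, a + a = 0 := by decide

/-- The lift of a difference that is prescribed for a gap between two blocks: the two gaps between
the same blocks are of different kinds, and `fwd` records the direction of travel. -/
def signedLift (kind fwd : Bool) (a : Klein) : Quat :=
  let g := if kind then a.lift else a.lift * Quat.z
  if fwd then g else g⁻¹

/-- The lifts of the four differences in a gap. A repeated difference is lifted in both ways. -/
def gapLift (kind fwd : Bool) (δ : Fin 4 → Klein) (m : Fin 4) : Quat :=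
  signedLift kind fwd (δ m) * if ∃ m' < m, δ m' = δ m then Quat.z else 1

theorem proj_signedLift : ∀ (kind fwd : Bool) (a : Klein),
    Quat.proj (signedLift kind fwd a) = a := by decide

theorem proj_gapLift (kind fwd : Bool) (δ : Fin 4 → Klein) (m : Fin 4) :
    Quat.proj (gapLift kind fwd δ m) = δ m := by
  rw [gapLift, Quat.proj_mul, proj_signedLift]
  split_ifs <;> simp [Quat.proj_z, Quat.proj_one]

theorem gapLift_of_lt {kind fwd : Bool} {δ : Fin 4 → Klein} {m m' : Fin 4} (h : m' < m)
    (hδ : δ m' = δ m) : gapLift kind fwd δ m = signedLift kind fwd (δ m) * Quat.z := by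
  rw [gapLift, if_pos ⟨m', h, hδ⟩]

theorem gapLift_of_first {kind fwd : Bool} {δ : Fin 4 → Klein} {m : Fin 4}
    (h : ∀ m' < m, δ m' ≠ δ m) : gapLift kind fwd δ m = signedLift kind fwd (δ m) := by
  rw [gapLift, if_neg (by push Not; exact h), mul_one]

theorem exists_first {δ : Fin 4 → Klein} {a : Klein} (h : ∃ m, δ m = a) :
    ∃ m, δ m = a ∧ ∀ m' < m, δ m' ≠ δ m := by
  obtain ⟨m, hm, hmin⟩ := WellFounded.has_min (wellFounded_lt (α := Fin 4)) {m | δ m = a} h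
  exact ⟨m, hm, fun m' hlt heq => hmin m' (heq.trans hm) hlt⟩

/-- The differences in a gap: all four of them once if `y = 0`, and otherwise one of `0`, `y`
(depending on the kind) twice and the other one not at all. -/
def GapGood (kind : Bool) (y : Klein) (δ : Fin 4 → Klein) : Prop :=
  (∀ a, (a ≠ (if kind then y else 0) ∨ y = 0) → ∃ m, δ m = a) ∧
    (y ≠ 0 → ∃ m m', m < m' ∧ δ m = (if kind then 0 else y) ∧ δ m' = if kind then 0 else y)

instance (kind : Bool) (y : Klein) (δ : Fin 4 → Klein) : Decidable (GapGood kind y δ) := by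
  unfold GapGood
  infer_instance

theorem signedLift_true : ∀ (fwd : Bool) (a : Klein),
    signedLift true fwd a = if fwd then a.lift else a.lift⁻¹ := by decide

theorem signedLift_true_mul_z : ∀ (fwd : Bool) (a : Klein), signedLift true fwd a * Quat.z =
    if fwd then a.lift * Quat.z else (a.lift * Quat.z)⁻¹ := by decide

theorem signedLift_false : ∀ (fwd : Bool) (a : Klein), signedLift false fwd a =
    if fwd then a.lift * Quat.z else (a.lift * Quat.z)⁻¹ := by decide

theorem signedLift_false_mul_z : ∀ (fwd : Bool) (a : Klein), signedLift false fwd a * Quat.z =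
    if fwd then a.lift else a.lift⁻¹ := by decide

/-- The lifts in two gaps of different kinds between the same blocks exhaust the quaternion
group. -/
theorem exists_gapLift_eq {y : Klein} {δ δ' : Fin 4 → Klein} (h : GapGood true y δ)
    (h' : GapGood false y δ') (fwd fwd' : Bool) (q : Quat) :
    (∃ m, gapLift true fwd δ m = if fwd then q else q⁻¹) ∨
      (∃ m, gapLift false fwd' δ' m = if fwd' then q else q⁻¹) := by
  rcases Quat.eq_or_eq_mul_z q (Quat.proj q).lift (Quat.proj_lift _).symm with hq | hq
  · by_cases hhit : ∃ m, δ m = Quat.proj q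
    · left
      obtain ⟨m, hm, hfirst⟩ := exists_first hhit
      refine ⟨m, ?_⟩
      rw [gapLift_of_first hfirst, signedLift_true, hm, ← hq]
    · right
      -- The gap of kind `true` lacks only the difference y; the other gap has y twice, and its
      -- second copy carries the extra z.
      have hy : ¬ (Quat.proj q ≠ y ∨ y = 0) := fun hy => hhit (h.1 _ hy)
      push Not at hy
      obtain ⟨m, m', hlt, hm, hm'⟩ := h'.2 hy.2
      simp only [Bool.false_eq_true, if_false] at hm hm'
      refine ⟨m', ?_⟩
      rw [gapLift_of_lt hlt (hm.trans hm'.symm), signedLift_false_mul_z, hm', ← hy.1, ← hq]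
  · by_cases hhit : ∃ m, δ' m = Quat.proj q
    · right
      obtain ⟨m, hm, hfirst⟩ := exists_first hhit
      refine ⟨m, ?_⟩
      rw [gapLift_of_first hfirst, signedLift_false, hm, ← hq]
    · left
      have hy : ¬ (Quat.proj q ≠ 0 ∨ y = 0) := fun hy => hhit (h'.1 _ hy)
      push Not at hy
      obtain ⟨m, m', hlt, hm, hm'⟩ := h.2 hy.2
      simp only [if_true] at hm hm'
      refine ⟨m', ?_⟩
      rw [gapLift_of_lt hlt (hm.trans hm'.symm), signedLift_true_mul_z, hm', ← hy.1, ← hq]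

/-! ### Strand values in the blocks -/

/-- A linear map of order three, applied only if `par` is set. -/
def twist (par : Bool) (a : Klein) : Klein := if par then (a.2, a.1 + a.2) else a

/-- The values of the four strands in the second block. -/
def strands (special par k₀ : Bool) (x y y' : Klein) (m : Fin 4) : Klein :=
  (if k₀ then 0 else y) +
    if special then
      if twist par y = y' then ![x + y, 0, x, y] m else ![x + y, x, 0, y] m
    else
      if twist par x = y' then ![y, 0, x + y, x] m else ![y, x + y, 0, x] m

/-- The value in the last block that is shared by the last two strands; `w` are the values of the
strands in the block before. -/
def lastShared (k₁ : Bool) (y' : Klein) (w : Fin 4 → Klein) : Klein :=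
  (if k₁ then 0 else y') +
    if w 2 = w 0 + twist true y' ∨ w 2 = w 1 + twist true y' + y' then w 2 else w 3

/-- The values of the four strands in the last block. -/
def lastBlock (y' s : Klein) : Fin 4 → Klein :=
  ![s + twist true y', s + twist true y' + y', s, s]

/-- The values of the four strands in the first block. -/
def firstBlock (x y : Klein) : Fin 4 → Klein := ![x + y, 0, 0, x]

theorem strands_surjective : ∀ (special par k₀ : Bool) (x y y' : Klein), x ≠ 0 → y ≠ 0 → x ≠ y →
    ∀ a, ∃ m, strands special par k₀ x y y' m = a := by decide

/-- The first block sums to y and the second to 0, so the missing and the repeated difference must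
differ by y. Adding y to all strands exchanges the roles of 0 and y, hence the dependence on `k₀`.
-/
theorem gapGood_first : ∀ (special par k₀ : Bool) (x y y' : Klein), x ≠ 0 → y ≠ 0 → x ≠ y →
    GapGood k₀ y fun m => firstBlock x y m + strands special par k₀ x y y' m := by decide

-- Write w for the values before the last block and T for the twist. `lastShared` makes the
-- difference of strand 2 or 3 vanish together with that of strand 0 or 1 (all shifted by y' if `k₁`
-- is false). A triple repetition would occur exactly when w 0 + w 1 = y'; the case distinction in
-- `strands` avoids this.
set_option synthInstance.maxSize 1000 in
set_option synthInstance.maxHeartbeats 400000 in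
theorem gapGood_last : ∀ (special par k₀ k₁ : Bool) (x y y' : Klein), x ≠ 0 → y ≠ 0 → x ≠ y →
    y' ≠ 0 → GapGood k₁ y' fun m => twist par (strands special par k₀ x y y' m) +
      lastBlock y' (lastShared k₁ y' fun m => twist par (strands special par k₀ x y y' m)) m := by
  decide

/-- Together with `first_not_special`, this separates base cycle 0 from the others: only there is
the difference of strand 0 repeated. -/
theorem first_special : ∀ (par k₀ : Bool) (x y y' : Klein), x ≠ 0 → y ≠ 0 → x ≠ y →
    ∃ m, (m = 1 ∨ m = 2) ∧ firstBlock x y m + strands true par k₀ x y y' m =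
      firstBlock x y 0 + strands true par k₀ x y y' 0 := by decide

set_option synthInstance.maxSize 1000 in
set_option synthInstance.maxHeartbeats 400000 in
theorem first_not_special : ∀ (par k₀ : Bool) (x y y' : Klein), x ≠ 0 → y ≠ 0 → x ≠ y →
    ∀ m, firstBlock x y m + strands false par k₀ x y y' m =
      firstBlock x y 0 + strands false par k₀ x y y' 0 → m = 0 := by decide

theorem twist_surjective : ∀ (par : Bool) (a : Klein), ∃ b, twist par b = a := by decide

/-- The twist T satisfies 1 + T + T² = 0, so 1 + T is invertible. Alternating between the identity
and T therefore makes all inner gaps have four distinct differences. -/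
theorem twist_add_twist_surjective : ∀ (par : Bool) (a : Klein),
    ∃ b, twist par b + twist (!par) b = a := by decide

theorem exists_firstBlock : ∀ x y : Klein, x ≠ 0 → y ≠ 0 → x ≠ y → ∀ a,
    a = y ∨ ∃ m, firstBlock x y m = a := by decide

theorem exists_lastBlock : ∀ y' s : Klein, y' ≠ 0 → ∀ a,
    a = s + y' ∨ ∃ m, lastBlock y' s m = a := by decide

/-- The two steps at the turn have differences T y' + y' and T y', the nonzero elements other than
y'. -/
theorem last_vertical : ∀ y' s : Klein, y' ≠ 0 → ∀ a, a ≠ 0 → a ≠ y' →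
    lastBlock y' s 0 + (s + y') = a ∨ (s + y') + lastBlock y' s 1 = a := by decide

end Klein

/-! ### Zigzag paths through the blocks -/

namespace Zigzag

variable {d : ℕ}

/-- The direction of the first step of the zigzag path starting at `u`. -/
def up (u : ZMod d) : Bool := decide (d % 2 = 1 ∨ 2 * u.val < d)

/-- The first step of the zigzag path starting at `u`. -/
def step (u : ZMod d) : ZMod d := if up u then 1 else -1

/-- The zigzag path `u, u + 1, u - 1, u + 2, …` or `u, u - 1, u + 1, u - 2, …`. -/
def zig (u : ZMod d) (k : ℕ) : ZMod d :=
  if k % 2 = 1 then u + step u * ((k + 1) / 2 : ℕ) else u - step u * (k / 2 : ℕ)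

/-- The sums of consecutive vertices of the zigzag path are `label u` and `label u + 1`. -/
def label (u : ZMod d) : ZMod d := if up u then 2 * u else 2 * u - 1

/-- Whether the sum of the vertices `k` and `k + 1` of the zigzag path is `label u`. -/
def kind (u : ZMod d) (k : ℕ) : Bool := decide (k % 2 = 1) == up u

theorem step_eq (u : ZMod d) : step u = 1 ∨ step u = -1 := by
  unfold step
  split_ifs <;> simp

theorem step_mul_step (u : ZMod d) : step u * step u = 1 := by
  rcases step_eq u with h | h <;> simp [h]

theorem zig_zero (u : ZMod d) : zig u 0 = u := by simp [zig]

theorem zig_two_mul (u : ZMod d) (l : ℕ) : zig u (2 * l) = u - step u * l := by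
  simp [zig]

theorem zig_two_mul_add_one (u : ZMod d) (l : ℕ) :
    zig u (2 * l + 1) = u + step u * (l + 1) := by
  rw [zig, if_pos (by omega), show (2 * l + 1 + 1) / 2 = l + 1 by omega]
  push_cast
  rfl

theorem kind_succ (u : ZMod d) (k : ℕ) : kind u (k + 1) = !kind u k := by
  unfold kind
  rcases Nat.mod_two_eq_zero_or_one k with h | h
  · rw [h, show (k + 1) % 2 = 1 by omega]
    cases up u <;> rfl
  · rw [h, show (k + 1) % 2 = 0 by omega]
    cases up u <;> rfl

theorem zig_add_zig_succ (u : ZMod d) (k : ℕ) :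
    zig u k + zig u (k + 1) = label u + if kind u k then 0 else 1 := by
  rcases Nat.even_or_odd' k with ⟨l, rfl | rfl⟩
  · rw [zig_two_mul, zig_two_mul_add_one]
    unfold kind label step
    cases h : up u <;> simp <;> ring
  · rw [zig_two_mul_add_one, show 2 * l + 1 + 1 = 2 * (l + 1) by ring, zig_two_mul]
    unfold kind label step
    have h1 : (2 * l + 1) % 2 = 1 := by omega
    cases h : up u <;> simp [h1] <;> ring

theorem zig_succ_sub (u : ZMod d) (k : ℕ) :
    zig u (k + 1) - zig u k = k + 1 ∨ zig u (k + 1) - zig u k = -(k + 1) := by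
  rcases Nat.even_or_odd' k with ⟨l, rfl | rfl⟩
  · rw [zig_two_mul, zig_two_mul_add_one]
    rcases step_eq u with h | h <;> rw [h] <;> push_cast
    · left; ring
    · right; ring
  · rw [zig_two_mul_add_one, show 2 * l + 1 + 1 = 2 * (l + 1) by ring, zig_two_mul]
    rcases step_eq u with h | h <;> rw [h] <;> push_cast
    · right; ring
    · left; ring

/-- Step k has length ±(k + 1), which vanishes for k = d - 1: past its end the zigzag would stay
put. -/
theorem zig_self (hd : 0 < d) (u : ZMod d) : zig u d = zig u (d - 1) := by
  obtain ⟨e, rfl⟩ : ∃ e, d = e + 1 := ⟨d - 1, by omega⟩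
  have h0 : ((e : ZMod (e + 1)) + 1) = 0 := by exact_mod_cast ZMod.natCast_self (e + 1)
  rw [Nat.add_sub_cancel]
  rcases zig_succ_sub u e with h | h
  · rw [h0] at h
    exact sub_eq_zero.1 h
  · rw [h0, neg_zero] at h
    exact sub_eq_zero.1 h

theorem exists_zig (hd : 0 < d) (u v : ZMod d) : ∃ k < d, zig u k = v := by
  have : NeZero d := ⟨hd.ne'⟩
  obtain ⟨r, hr⟩ : ∃ r : ZMod d, r = step u * (v - u) := ⟨_, rfl⟩
  have hv : v = u + step u * r := by
    rw [hr, ← mul_assoc, step_mul_step]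
    ring
  have hlt := r.val_lt
  have hrv : ((r.val : ℕ) : ZMod d) = r := ZMod.natCast_zmod_val r
  by_cases h0 : r.val = 0
  · refine ⟨0, hd, ?_⟩
    rw [h0, Nat.cast_zero] at hrv
    rw [hv, ← hrv, zig_zero]
    ring
  by_cases h : 2 * r.val ≤ d
  · refine ⟨2 * (r.val - 1) + 1, by omega, ?_⟩
    rw [zig_two_mul_add_one, hv, Nat.cast_sub (by omega), hrv]
    ring
  · refine ⟨2 * (d - r.val), by omega, ?_⟩
    rw [zig_two_mul, hv, Nat.cast_sub hlt.le, hrv, ZMod.natCast_self]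
    ring

theorem val_natCast_lt {a : ℕ} (h : a < d) : ((a : ℕ) : ZMod d).val = a := by
  rw [ZMod.val_natCast, Nat.mod_eq_of_lt h]

/-- For odd d doubling is bijective. For even d the starts with 2u < d give the even labels and the
others the odd ones. -/
theorem exists_label (hd : 0 < d) (s : ZMod d) : ∃ u, label u = s := by
  have : NeZero d := ⟨hd.ne'⟩
  have hlt := s.val_lt
  have hs : ((s.val : ℕ) : ZMod d) = s := ZMod.natCast_zmod_val s
  have h0 : (d : ZMod d) = 0 := ZMod.natCast_self d
  have key : ∀ a < d, (d % 2 = 1 ∨ 2 * a < d) → (2 * a = s.val ∨ 2 * a = s.val + d) →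
      ∃ u, label u = s := by
    intro a ha hup h
    refine ⟨a, ?_⟩
    rw [label, if_pos (by simpa [up, val_natCast_lt ha] using hup)]
    rcases h with h | h
    · rw [← hs, ← h]
      push_cast
      rfl
    · have h1 := congrArg (Nat.cast : ℕ → ZMod d) h
      push_cast at h1
      rw [h1, hs, h0, add_zero]
  have key' : ∀ a < d, ¬ (d % 2 = 1 ∨ 2 * a < d) →
      (2 * a = s.val + 1 ∨ 2 * a = s.val + 1 + d) → ∃ u, label u = s := by
    intro a ha hup h
    refine ⟨a, ?_⟩
    rw [label, if_neg (by simpa [up, val_natCast_lt ha] using hup)]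
    rcases h with h | h
    · have h1 := congrArg (Nat.cast : ℕ → ZMod d) h
      push_cast at h1
      rw [h1, hs]
      ring
    · have h1 := congrArg (Nat.cast : ℕ → ZMod d) h
      push_cast at h1
      rw [h1, hs, h0]
      ring
  rcases Nat.mod_two_eq_zero_or_one s.val with hs2 | hs2
  · exact key (s.val / 2) (by omega) (by omega) (by omega)
  · rcases Nat.mod_two_eq_zero_or_one d with hd2 | hd2
    · by_cases hlast : s.val + 1 = d
      · exact key' (d / 2) (by omega) (by omega) (by omega)
      · exact key' ((s.val + 1 + d) / 2) (by omega) (by omega) (by omega)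
    · exact key ((s.val + d) / 2) (by omega) (by omega) (by omega)

theorem one_ne_zero_of (hd : 3 ≤ d) : (1 : ZMod d) ≠ 0 := by
  have : Fact (1 < d) := ⟨by omega⟩
  exact one_ne_zero

/-- Any two blocks are consecutive in exactly one zigzag path of either kind. -/
theorem exists_gap (hd : 3 ≤ d) {i j : ZMod d} (hij : i ≠ j) (K : Bool) :
    ∃ u k, k + 1 < d ∧ kind u k = K ∧ (label u + if K then 0 else 1) = i + j ∧
      ((zig u k = i ∧ zig u (k + 1) = j) ∨ (zig u k = j ∧ zig u (k + 1) = i)) := by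
  obtain ⟨u, hu⟩ := exists_label (by omega) (i + j - if K then 0 else 1)
  have hsum : (label u + if K then 0 else 1) = i + j := by rw [hu]; ring
  obtain ⟨k, hk, hki⟩ := exists_zig (by omega) u i
  -- Kinds alternate, so the wanted step either leaves i or enters it. There is no partner only at
  -- an end of the zigzag, and there the sum condition would give i = j.
  by_cases hK : kind u k = K
  · have hj : zig u (k + 1) = j := by
      have h := zig_add_zig_succ u k
      rw [hK, hsum, hki] at h
      exact add_left_cancel h
    refine ⟨u, k, ?_, hK, hsum, Or.inl ⟨hki, hj⟩⟩
    by_contra hlt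
    obtain rfl : k = d - 1 := by omega
    rw [show d - 1 + 1 = d by omega, zig_self (by omega), hki] at hj
    exact hij hj
  · cases k with
    | zero =>
      exfalso
      rw [zig_zero] at hki
      subst hki
      apply hij
      have hK' : K = up u := by
        revert hK
        unfold kind
        cases K <;> cases up u <;> decide
      rw [hK'] at hsum
      revert hsum
      unfold label
      cases up u
      · simp only [Bool.false_eq_true, if_false]
        intro h
        linear_combination h
      · simp only [if_true]
        intro h
        linear_combination h
    | succ k =>
      have hK' : kind u k = K := by
        rw [kind_succ] at hK
        revert hK
        cases kind u k <;> cases K <;> decide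
      have hj : zig u k = j := by
        have h := zig_add_zig_succ u k
        rw [hK', hsum, hki] at h
        linear_combination h
      exact ⟨u, k, hk, hK', hsum, Or.inr ⟨hj, hki⟩⟩

theorem ne_of_gap (hd : 3 ≤ d) {i j u u' : ZMod d} {K K' : Bool} (hK : K ≠ K')
    (h : (label u + if K then 0 else 1) = i + j) (h' : (label u' + if K' then 0 else 1) = i + j) :
    u ≠ u' := by
  rintro rfl
  apply one_ne_zero_of hd
  revert h h' hK
  cases K <;> cases K' <;> simp <;> intro h h' <;>
    first | linear_combination h - h' | linear_combination h' - h

/-- A step of length ±(k + 1) equals ±1 modulo d only at the two ends. -/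
theorem eq_zero_or_eq_of_adjacent (hd : 3 ≤ d) (u : ZMod d) {k : ℕ} (hk : k + 1 < d)
    (h : zig u (k + 1) = zig u k + 1 ∨ zig u k = zig u (k + 1) + 1) : k = 0 ∨ k = d - 2 := by
  have h1 : ((k : ℕ) : ZMod d) = 0 ∨ ((k + 2 : ℕ) : ZMod d) = 0 := by
    push_cast
    rcases h with h | h <;> rcases zig_succ_sub u k with h2 | h2
    · left; linear_combination h - h2
    · right; linear_combination h2 - h
    · right; linear_combination -h - h2
    · left; linear_combination h + h2
  rcases h1 with h1 | h1
  · left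
    exact Nat.eq_zero_of_dvd_of_lt ((ZMod.natCast_eq_zero_iff _ _).1 h1) (by omega)
  · right
    have := Nat.le_of_dvd (by omega) ((ZMod.natCast_eq_zero_iff _ _).1 h1)
    omega

/-- The last vertex of the zigzag path starting at `u`. -/
def last (u : ZMod d) : ZMod d := zig u (d - 1)

/-- The zigzag ending at a block arrives along the edge of the cycle not used by the zigzag starting
there. For odd d every first step is +1; for even d the two ends lie in opposite halves and have
opposite first steps. -/
theorem zig_before_last (hd : 3 ≤ d) (u : ZMod d) : zig u (d - 2) = last u - step (last u) := by
  have : NeZero d := ⟨by omega⟩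
  have h0 : (d : ZMod d) = 0 := ZMod.natCast_self d
  unfold last
  rcases Nat.even_or_odd' d with ⟨l, hl | hl⟩
  · have h0' : (2 : ZMod d) * l = 0 := by
      have h := congrArg (Nat.cast : ℕ → ZMod d) hl
      rw [h0] at h
      push_cast at h
      exact h.symm
    have e1 : zig u (d - 2) = u - step u * (l - 1) := by
      rw [show d - 2 = 2 * (l - 1) by omega, zig_two_mul, Nat.cast_sub (by omega), Nat.cast_one]
    have e2 : zig u (d - 1) = u + step u * l := by
      rw [show d - 1 = 2 * (l - 1) + 1 by omega, zig_two_mul_add_one, Nat.cast_sub (by omega)]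
      push_cast
      ring
    have hlt := u.val_lt
    have hu : ((u.val : ℕ) : ZMod d) = u := ZMod.natCast_zmod_val u
    have e3 : step (zig u (d - 1)) = -step u := by
      rw [e2]
      unfold step up
      by_cases h : 2 * u.val < d
      · have hv : (u + (1 : ZMod d) * l).val = u.val + l := by
          rw [← val_natCast_lt (d := d) (a := u.val + l) (by omega)]
          push_cast
          rw [hu, one_mul]
        rw [if_pos (by simp [h] : decide (d % 2 = 1 ∨ 2 * u.val < d) = true), hv,
          if_neg (by simp; omega)]
      · have hv : (u + (-1 : ZMod d) * l).val = u.val - l := by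
          rw [← val_natCast_lt (d := d) (a := u.val - l) (by omega), Nat.cast_sub (by omega), hu]
          ring_nf
        rw [if_neg (by simp; omega : ¬ decide (d % 2 = 1 ∨ 2 * u.val < d) = true), hv,
          if_pos (by simp; omega), neg_neg]
    rw [e3, e1, e2]
    linear_combination (-step u) * h0'
  · have h0' : (2 : ZMod d) * l + 1 = 0 := by
      have h := congrArg (Nat.cast : ℕ → ZMod d) hl
      rw [h0] at h
      push_cast at h
      exact h.symm
    have hs : ∀ v : ZMod d, step v = 1 := by
      intro v
      have : d % 2 = 1 := by omega
      simp [step, up, this]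
    have e1 : zig u (d - 2) = u + l := by
      rw [show d - 2 = 2 * (l - 1) + 1 by omega, zig_two_mul_add_one, Nat.cast_sub (by omega), hs]
      push_cast
      ring
    have e2 : zig u (d - 1) = u - l := by
      rw [show d - 1 = 2 * l by omega, zig_two_mul, hs, one_mul]
    rw [hs, e1, e2]
    linear_combination h0'

theorem exists_last (hd : 3 ≤ d) (i : ZMod d) : ∃ u, last u = i := by
  have h0 : (d : ZMod d) = 0 := ZMod.natCast_self d
  unfold last
  rcases Nat.even_or_odd' d with ⟨l, hl | hl⟩
  · have h0' : (2 : ZMod d) * l = 0 := by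
      have h := congrArg (Nat.cast : ℕ → ZMod d) hl
      rw [h0] at h
      push_cast at h
      exact h.symm
    refine ⟨i + l, ?_⟩
    rw [show d - 1 = 2 * (l - 1) + 1 by omega, zig_two_mul_add_one, Nat.cast_sub (by omega)]
    rcases step_eq (i + l : ZMod d) with h | h <;> rw [h] <;> push_cast
    · linear_combination h0'
    · ring
  · refine ⟨i + l, ?_⟩
    have hs : step (i + l : ZMod d) = 1 := by
      have : d % 2 = 1 := by omega
      simp [step, up, this]
    rw [show d - 1 = 2 * l by omega, zig_two_mul, hs]
    ring

theorem last_ne (hd : 3 ≤ d) (u : ZMod d) : last u ≠ u := by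
  have : NeZero d := ⟨by omega⟩
  have hsurj : Function.Surjective fun k : Fin d => zig u k := by
    intro v
    obtain ⟨k, hk, h⟩ := exists_zig (by omega) u v
    exact ⟨⟨k, hk⟩, h⟩
  have hinj := ((Fintype.bijective_iff_surjective_and_card _).2 ⟨hsurj, by simp⟩).1
  intro h
  have := @hinj ⟨d - 1, by omega⟩ ⟨0, by omega⟩ (by simpa [zig_zero, last] using h)
  simp only [Fin.mk.injEq] at this
  omega

/-! ### Colouring the adjacent pairs of blocks -/

/-- A proper colouring of the edges `{i, i + 1}` of the cycle by nonzero elements. -/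
def colour (i : ZMod d) : Klein :=
  if i.val = d - 1 then (1, 1) else if i.val % 2 = 0 then (1, 0) else (0, 1)

theorem colour_ne_zero (i : ZMod d) : colour i ≠ 0 := by
  unfold colour
  split_ifs <;> decide

theorem colour_ne (hd : 3 ≤ d) (i : ZMod d) : colour i ≠ colour (i - 1) := by
  have : NeZero d := ⟨by omega⟩
  have hlt := i.val_lt
  have hi : ((i.val : ℕ) : ZMod d) = i := ZMod.natCast_zmod_val i
  have hv : (i - 1).val = if i.val = 0 then d - 1 else i.val - 1 := by
    split_ifs with h
    · rw [h, Nat.cast_zero] at hi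
      rw [← hi, ← val_natCast_lt (d := d) (a := d - 1) (by omega), Nat.cast_sub (by omega),
        ZMod.natCast_self, Nat.cast_one]
    · rw [← val_natCast_lt (d := d) (a := i.val - 1) (by omega), Nat.cast_sub (by omega), hi,
        Nat.cast_one]
  unfold colour
  rw [hv]
  split_ifs <;> first | omega | decide

/-- The colour of the edge at `u` with which the zigzag path starting at `u` begins. -/
def startColour (u : ZMod d) : Klein := if up u then colour u else colour (u - 1)

/-- The colour of the other edge at `u`, with which some zigzag path ends. -/
def endColour (u : ZMod d) : Klein := if up u then colour (u - 1) else colour u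

theorem startColour_ne_zero (u : ZMod d) : startColour u ≠ 0 := by
  unfold startColour
  split_ifs <;> exact colour_ne_zero _

theorem endColour_ne_zero (u : ZMod d) : endColour u ≠ 0 := by
  unfold endColour
  split_ifs <;> exact colour_ne_zero _

theorem endColour_ne_startColour (hd : 3 ≤ d) (u : ZMod d) : endColour u ≠ startColour u := by
  unfold endColour startColour
  split_ifs
  · exact (colour_ne hd u).symm
  · exact colour_ne hd u

/-- The colour of a pair of blocks, zero unless they are adjacent in the cycle. -/
def pairColour (i j : ZMod d) : Klein :=
  if j = i + 1 then colour i else if i = j + 1 then colour j else 0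

theorem pairColour_succ (i : ZMod d) : pairColour i (i + 1) = colour i := by
  simp [pairColour]

theorem pairColour_comm (hd : 3 ≤ d) (i j : ZMod d) : pairColour i j = pairColour j i := by
  unfold pairColour
  by_cases h1 : j = i + 1
  · have h2 : ¬ i = j + 1 := fun h2 => two_ne_zero_of_three_le hd (by linear_combination -h1 - h2)
    rw [if_pos h1, if_neg h2, if_pos h1]
  · rw [if_neg h1]
    simp only [h1, if_false]

theorem pairColour_pred (hd : 3 ≤ d) (i : ZMod d) : pairColour i (i - 1) = colour (i - 1) := by
  rw [pairColour_comm hd]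
  have h := pairColour_succ (i - 1)
  rwa [sub_add_cancel] at h

theorem pairColour_first (hd : 3 ≤ d) (u : ZMod d) :
    pairColour (zig u 0) (zig u 1) = startColour u := by
  have h1 : zig u 1 = u + step u := by simpa using zig_two_mul_add_one u 0
  rw [zig_zero, h1]
  unfold step startColour
  split_ifs
  · exact pairColour_succ u
  · rw [← sub_eq_add_neg]
    exact pairColour_pred hd u

theorem pairColour_last (hd : 3 ≤ d) (u : ZMod d) :
    pairColour (zig u (d - 2)) (zig u (d - 1)) = endColour (last u) := by
  rw [zig_before_last hd, ← last, pairColour_comm hd]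
  unfold step endColour
  split_ifs
  · exact pairColour_pred hd _
  · rw [sub_neg_eq_add]
    exact pairColour_succ _

theorem pairColour_inner (hd : 3 ≤ d) (u : ZMod d) {k : ℕ} (hk : k + 1 < d) (h0 : k ≠ 0)
    (h1 : k ≠ d - 2) : pairColour (zig u k) (zig u (k + 1)) = 0 := by
  have h := mt (eq_zero_or_eq_of_adjacent hd u hk) (by tauto)
  push Not at h
  rw [pairColour, if_neg h.1, if_neg h.2]

end Zigzag

open Zigzag Klein

/-! ### The four-strand path in the quaternion group -/

section Path

variable {d : ℕ} (u : ZMod d)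

/-- The values of the four strands of the path starting at `u` in the second block. -/
def innerBlock : Fin 4 → Klein :=
  strands (decide (u = 0)) (decide ((d - 2) % 2 = 0)) (kind u 0) (endColour u) (startColour u)
    (endColour (last u))

/-- The value shared by two strands of the path starting at `u` in the last block. -/
def sharedValue : Klein :=
  lastShared (kind u (d - 2)) (endColour (last u))
    fun m => twist (decide ((d - 2) % 2 = 0)) (innerBlock u m)

/-- The value of strand `m` of the path starting at `u` in block `k`. -/
def strand (m : Fin 4) (k : ℕ) : Klein :=
  if k = 0 then firstBlock (endColour u) (startColour u) m
  else if k = d - 1 then lastBlock (endColour (last u)) (sharedValue u) m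
  else twist (decide (k % 2 = 0)) (innerBlock u m)

/-- The value of the path starting at `u` between its first two strands. -/
def turnValue : Klein := sharedValue u + endColour (last u)

/-- The differences of the four strands between the blocks `k` and `k + 1`. -/
def gapDiff (k : ℕ) (m : Fin 4) : Klein := strand u m k + strand u m (k + 1)

variable {u}

theorem strand_zero (m : Fin 4) : strand u m 0 = firstBlock (endColour u) (startColour u) m := by
  simp [strand]

theorem strand_one (hd : 3 ≤ d) (m : Fin 4) : strand u m 1 = innerBlock u m := by
  rw [strand, if_neg one_ne_zero, if_neg (by omega)]
  simp [twist]

theorem strand_last (hd : 3 ≤ d) (m : Fin 4) :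
    strand u m (d - 1) = lastBlock (endColour (last u)) (sharedValue u) m := by
  rw [strand, if_neg (by omega), if_pos rfl]

theorem strand_inner {k : ℕ} (h0 : k ≠ 0) (h1 : k ≠ d - 1) (m : Fin 4) :
    strand u m k = twist (decide (k % 2 = 0)) (innerBlock u m) := by
  rw [strand, if_neg h0, if_neg h1]

theorem innerBlock_surjective (hd : 3 ≤ d) (a : Klein) : ∃ m, innerBlock u m = a :=
  strands_surjective _ _ _ _ _ _ (endColour_ne_zero u) (startColour_ne_zero u)
    (endColour_ne_startColour hd u) a

/-- The defect of a gap is the colour of its pair of blocks: nonzero in the first and last gap, zero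
between inner blocks, where the twist makes the differences distinct. -/
theorem gapGood_gapDiff (hd : 3 ≤ d) {k : ℕ} (hk : k + 1 < d) :
    GapGood (kind u k) (pairColour (zig u k) (zig u (k + 1))) (gapDiff u k) := by
  have hx := endColour_ne_zero u
  have hy := startColour_ne_zero u
  have hxy := endColour_ne_startColour hd u
  by_cases h0 : k = 0
  · subst h0
    rw [zero_add, pairColour_first hd]
    have h : gapDiff u 0 = fun m => firstBlock (endColour u) (startColour u) m +
        innerBlock u m := by
      funext m
      rw [gapDiff, strand_zero, zero_add, strand_one hd]
    rw [h]
    exact gapGood_first _ _ _ _ _ _ hx hy hxy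
  by_cases h1 : k = d - 2
  · subst h1
    have h2 : d - 2 + 1 = d - 1 := by omega
    have h : gapDiff u (d - 2) = fun m => twist (decide ((d - 2) % 2 = 0)) (innerBlock u m) +
        lastBlock (endColour (last u)) (sharedValue u) m := by
      funext m
      rw [gapDiff, strand_inner h0 (by omega), h2, strand_last hd]
    rw [h2, pairColour_last hd, h]
    exact gapGood_last _ _ _ _ _ _ _ hx hy hxy (endColour_ne_zero _)
  · rw [pairColour_inner hd u hk h0 h1]
    refine ⟨fun a _ => ?_, fun h => absurd rfl h⟩
    obtain ⟨b, hb⟩ := twist_add_twist_surjective (decide (k % 2 = 0)) a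
    obtain ⟨m, rfl⟩ := innerBlock_surjective (u := u) hd b
    refine ⟨m, ?_⟩
    have h3 : decide ((k + 1) % 2 = 0) = !decide (k % 2 = 0) := by
      rcases Nat.mod_two_eq_zero_or_one k with h | h
      · simp [h, show (k + 1) % 2 = 1 by omega]
      · simp [h, show (k + 1) % 2 = 0 by omega]
    rw [gapDiff, strand_inner h0 (by omega), strand_inner (by omega) (by omega), h3, hb]

/-- An inner block is filled by the four strands. In an end block two strands share a vertex, and
the extra vertex there supplies the missing value. -/
theorem exists_strand (hd : 3 ≤ d) (k : ℕ) (a : Klein) :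
    (k = 0 ∧ a = startColour u) ∨ (k = d - 1 ∧ a = turnValue u) ∨ ∃ m, strand u m k = a := by
  by_cases h0 : k = 0
  · subst h0
    simp only [strand_zero]
    have := exists_firstBlock _ _ (endColour_ne_zero u) (startColour_ne_zero u)
      (endColour_ne_startColour hd u) a
    tauto
  by_cases h1 : k = d - 1
  · subst h1
    simp only [strand_last hd]
    have := exists_lastBlock (endColour (last u)) (sharedValue u) (endColour_ne_zero _) a
    unfold turnValue
    tauto
  · right
    right
    obtain ⟨b, rfl⟩ := twist_surjective (decide (k % 2 = 0)) a
    obtain ⟨m, rfl⟩ := innerBlock_surjective (u := u) hd b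
    exact ⟨m, strand_inner h0 h1 m⟩

variable (u)

/-- The lift of the difference of strand `m` between the blocks `k` and `k + 1`. -/
def strandLift (m : Fin 4) (k : ℕ) : Quat :=
  gapLift (kind u k) (decide ((zig u k).val < (zig u (k + 1)).val)) (gapDiff u k) m

/-- The quotients of consecutive elements of the path starting at `u`. -/
def pathStep (n : ℕ) : Quat :=
  if n = 0 then (endColour u).lift
  else if n < d then strandLift u 0 (n - 1)
  else if n = d then (strand u 0 (d - 1) + turnValue u).lift
  else if n = d + 1 then (turnValue u + strand u 1 (d - 1)).lift
  else if n < 2 * d + 1 then (strandLift u 1 (2 * d - n))⁻¹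
  else if n < 3 * d then strandLift u 2 (n - (2 * d + 1))
  else (strandLift u 3 (4 * d - 2 - n))⁻¹

/-- The path starting at `u`, without its blocks. -/
def path : ℕ → Quat
  | 0 => (startColour u).lift
  | n + 1 => path n * pathStep u n

/-- The position of a vertex of a path in its zigzag path. -/
def blockIndex (d n : ℕ) : ℕ :=
  if n ≤ d then n - 1
  else if n = d + 1 then d - 1
  else if n ≤ 2 * d + 1 then 2 * d + 1 - n
  else if n ≤ 3 * d then n - (2 * d + 1)
  else 4 * d - 1 - n

variable {u}

theorem path_succ (n : ℕ) : path u (n + 1) = path u n * pathStep u n := rfl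

theorem proj_strandLift (m : Fin 4) (k : ℕ) :
    Quat.proj (strandLift u m k) = strand u m k + strand u m (k + 1) :=
  proj_gapLift _ _ _ _

theorem pathStep_zero : pathStep u 0 = (endColour u).lift := by
  simp [pathStep]

theorem pathStep_strand_zero {k : ℕ} (hk : k + 1 < d) :
    pathStep u (k + 1) = strandLift u 0 k := by
  rw [pathStep, if_neg (by omega), if_pos hk, Nat.add_sub_cancel]

theorem pathStep_turn (hd : 3 ≤ d) : pathStep u d = (strand u 0 (d - 1) + turnValue u).lift := by
  rw [pathStep, if_neg (by omega), if_neg (by omega), if_pos rfl]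

theorem pathStep_turn_succ (hd : 3 ≤ d) :
    pathStep u (d + 1) = (turnValue u + strand u 1 (d - 1)).lift := by
  rw [pathStep, if_neg (by omega), if_neg (by omega), if_neg (by omega), if_pos rfl]

theorem pathStep_strand_one (hd : 3 ≤ d) {k : ℕ} (hk : k + 1 < d) :
    pathStep u (2 * d - k) = (strandLift u 1 k)⁻¹ := by
  rw [pathStep, if_neg (by omega), if_neg (by omega), if_neg (by omega), if_neg (by omega),
    if_pos (by omega), show 2 * d - (2 * d - k) = k by omega]

theorem pathStep_strand_two (hd : 3 ≤ d) {k : ℕ} (hk : k + 1 < d) :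
    pathStep u (2 * d + 1 + k) = strandLift u 2 k := by
  rw [pathStep, if_neg (by omega), if_neg (by omega), if_neg (by omega), if_neg (by omega),
    if_neg (by omega), if_pos (by omega), Nat.add_sub_cancel_left]

theorem pathStep_strand_three (hd : 3 ≤ d) {k : ℕ} (hk : k + 1 < d) :
    pathStep u (4 * d - 2 - k) = (strandLift u 3 k)⁻¹ := by
  rw [pathStep, if_neg (by omega), if_neg (by omega), if_neg (by omega), if_neg (by omega),
    if_neg (by omega), if_neg (by omega), show 4 * d - 2 - (4 * d - 2 - k) = k by omega]

theorem add_add_cancel (a b : Klein) : a + (a + b) = b := by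
  rw [← add_assoc, Klein.add_self, zero_add]

theorem proj_path_zero : Quat.proj (path u 0) = startColour u := Quat.proj_lift _

theorem proj_path_strand_zero {k : ℕ} (hk : k < d) :
    Quat.proj (path u (k + 1)) = strand u 0 k := by
  induction k with
  | zero =>
    rw [path_succ, Quat.proj_mul, proj_path_zero, pathStep_zero, Quat.proj_lift, strand_zero]
    simp [firstBlock, add_comm]
  | succ k ih =>
    rw [path_succ, Quat.proj_mul, ih (by omega), pathStep_strand_zero hk, proj_strandLift,
      add_add_cancel]

theorem proj_path_turn (hd : 3 ≤ d) : Quat.proj (path u (d + 1)) = turnValue u := by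
  have h := proj_path_strand_zero (u := u) (k := d - 1) (by omega)
  rw [show d - 1 + 1 = d by omega] at h
  rw [path_succ, Quat.proj_mul, h, pathStep_turn hd, Quat.proj_lift, add_add_cancel]

theorem proj_path_strand_one (hd : 3 ≤ d) {k : ℕ} (hk : k < d) :
    Quat.proj (path u (2 * d + 1 - k)) = strand u 1 k := by
  obtain ⟨j, hj⟩ : ∃ j, j + k = d - 1 := ⟨d - 1 - k, by omega⟩
  induction j generalizing k with
  | zero =>
    obtain rfl : k = d - 1 := by omega
    rw [show 2 * d + 1 - (d - 1) = d + 1 + 1 by omega, path_succ, Quat.proj_mul,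
      proj_path_turn hd, pathStep_turn_succ hd, Quat.proj_lift, add_add_cancel]
  | succ j ih =>
    have h := ih (k := k + 1) (by omega) (by omega)
    rw [show 2 * d + 1 - (k + 1) = 2 * d - k by omega] at h
    rw [show 2 * d + 1 - k = 2 * d - k + 1 by omega, path_succ, Quat.proj_mul, h,
      pathStep_strand_one hd (by omega), Quat.proj_inv, proj_strandLift, add_comm (strand u 1 k),
      add_add_cancel]

theorem proj_path_strand_two (hd : 3 ≤ d) {k : ℕ} (hk : k < d) :
    Quat.proj (path u (2 * d + 1 + k)) = strand u 2 k := by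
  induction k with
  | zero =>
    have h := proj_path_strand_one (u := u) hd (k := 0) (by omega)
    rw [Nat.sub_zero] at h
    rw [add_zero, h, strand_zero, strand_zero]
    rfl
  | succ k ih =>
    rw [← add_assoc, path_succ, Quat.proj_mul, ih (by omega), pathStep_strand_two hd hk,
      proj_strandLift, add_add_cancel]

theorem proj_path_strand_three (hd : 3 ≤ d) {k : ℕ} (hk : k < d) :
    Quat.proj (path u (4 * d - 1 - k)) = strand u 3 k := by
  obtain ⟨j, hj⟩ : ∃ j, j + k = d - 1 := ⟨d - 1 - k, by omega⟩
  induction j generalizing k with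
  | zero =>
    obtain rfl : k = d - 1 := by omega
    have h := proj_path_strand_two (u := u) hd (k := d - 1) (by omega)
    rw [show 2 * d + 1 + (d - 1) = 4 * d - 1 - (d - 1) by omega] at h
    rw [h, strand_last hd, strand_last hd]
    rfl
  | succ j ih =>
    have h := ih (k := k + 1) (by omega) (by omega)
    rw [show 4 * d - 1 - (k + 1) = 4 * d - 2 - k by omega] at h
    rw [show 4 * d - 1 - k = 4 * d - 2 - k + 1 by omega, path_succ, Quat.proj_mul, h,
      pathStep_strand_three hd (by omega), Quat.proj_inv, proj_strandLift,
      add_comm (strand u 3 k), add_add_cancel]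

/-- Every element of every block is visited, up to the central involution. -/
theorem exists_proj_path (hd : 3 ≤ d) {k : ℕ} (hk : k < d) (a : Klein) :
    ∃ n < 4 * d, blockIndex d n = k ∧ Quat.proj (path u n) = a := by
  rcases exists_strand (u := u) hd k a with ⟨rfl, rfl⟩ | ⟨rfl, rfl⟩ | ⟨m, rfl⟩
  · exact ⟨0, by omega, by simp [blockIndex], proj_path_zero⟩
  · exact ⟨d + 1, by omega, by simp [blockIndex], proj_path_turn hd⟩
  · fin_cases m
    · exact ⟨k + 1, by omega, by unfold blockIndex; split_ifs <;> omega,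
        proj_path_strand_zero hk⟩
    · exact ⟨2 * d + 1 - k, by omega, by unfold blockIndex; split_ifs <;> omega,
        proj_path_strand_one hd hk⟩
    · exact ⟨2 * d + 1 + k, by omega, by unfold blockIndex; split_ifs <;> omega,
        proj_path_strand_two hd hk⟩
    · exact ⟨4 * d - 1 - k, by omega, by unfold blockIndex; split_ifs <;> omega,
        proj_path_strand_three hd hk⟩

/-! ### Quotients realised between two blocks -/

variable (u)

/-- The path starting at `u` has an edge between the blocks `i` and `j` with quotient `q`. -/
def Link (i j : ZMod d) (q : Quat) : Prop :=
  ∃ n, n + 1 < 4 * d ∧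
    ((zig u (blockIndex d n) = i ∧ zig u (blockIndex d (n + 1)) = j ∧
        path u (n + 1) = path u n * q) ∨
      (zig u (blockIndex d n) = j ∧ zig u (blockIndex d (n + 1)) = i ∧
        path u (n + 1) = path u n * q⁻¹))

variable {u}

theorem Link.symm {i j : ZMod d} {q : Quat} (h : Link u i j q) : Link u j i q⁻¹ := by
  obtain ⟨n, hn, h | h⟩ := h
  · exact ⟨n, hn, Or.inr (by simpa using h)⟩
  · exact ⟨n, hn, Or.inl (by simpa using h)⟩

theorem link_strandLift (hd : 3 ≤ d) {k : ℕ} (hk : k + 1 < d) (m : Fin 4) :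
    Link u (zig u k) (zig u (k + 1)) (strandLift u m k) := by
  fin_cases m
  · refine ⟨k + 1, by omega, Or.inl ⟨?_, ?_, by rw [path_succ, pathStep_strand_zero hk]; rfl⟩⟩ <;>
      congr 1 <;> unfold blockIndex <;> split_ifs <;> omega
  · refine ⟨2 * d - k, by omega,
      Or.inr ⟨?_, ?_, by rw [path_succ, pathStep_strand_one hd hk]; rfl⟩⟩ <;>
      congr 1 <;> unfold blockIndex <;> split_ifs <;> omega
  · refine ⟨2 * d + 1 + k, by omega,
      Or.inl ⟨?_, ?_, by rw [path_succ, pathStep_strand_two hd hk]; rfl⟩⟩ <;>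
      congr 1 <;> unfold blockIndex <;> split_ifs <;> omega
  · refine ⟨4 * d - 2 - k, by omega,
      Or.inr ⟨?_, ?_, by rw [path_succ, pathStep_strand_three hd hk]; rfl⟩⟩ <;>
      congr 1 <;> unfold blockIndex <;> split_ifs <;> omega

theorem zig_ne_zig_succ (u : ZMod d) {k : ℕ} (hk : k + 1 < d) : zig u k ≠ zig u (k + 1) := by
  intro h
  have h0 : ((k + 1 : ℕ) : ZMod d) = 0 := by
    push_cast
    rcases zig_succ_sub u k with h1 | h1 <;> rw [h, sub_self] at h1
    · exact h1.symm
    · exact neg_eq_zero.1 h1.symm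
  have := Nat.le_of_dvd (by omega) ((ZMod.natCast_eq_zero_iff _ _).1 h0)
  omega

/-- The quotients that do not occur in a gap occur in a gap of another path between the same
blocks. -/
theorem exists_link_of_gap (hd : 3 ≤ d) {k : ℕ} (hk : k + 1 < d) :
    ∃ u', u' ≠ u ∧ ∀ q, (∃ m, strandLift u m k = q) ∨ Link u' (zig u k) (zig u (k + 1)) q := by
  have hne := zig_ne_zig_succ u hk
  obtain ⟨u', k', hk', hkind, hsum, hij⟩ := exists_gap hd hne (!kind u k)
  have huu : u ≠ u' := ne_of_gap hd (by simp) (zig_add_zig_succ u k).symm hsum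
  refine ⟨u', huu.symm, fun q => ?_⟩
  have hval : (zig u k).val ≠ (zig u (k + 1)).val := by
    have : NeZero d := ⟨by omega⟩
    exact fun h => hne (ZMod.val_injective d h)
  have hcol : pairColour (zig u' k') (zig u' (k' + 1)) =
      pairColour (zig u k) (zig u (k + 1)) := by
    rcases hij with ⟨h1, h2⟩ | ⟨h1, h2⟩
    · rw [h1, h2]
    · rw [h1, h2, pairColour_comm hd]
  have hgood := gapGood_gapDiff (u := u) hd hk
  have hgood' := gapGood_gapDiff (u := u') hd hk'
  rw [hcol, hkind] at hgood'
  -- Lifts are normalised by comparing representatives of the blocks, so that two zigzags crossing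
  -- the same pair in opposite directions use inverse conventions.
  obtain ⟨fwd, hfwd⟩ : ∃ b, b = decide ((zig u k).val < (zig u (k + 1)).val) := ⟨_, rfl⟩
  obtain ⟨fwd', hfwd'⟩ : ∃ b, b = decide ((zig u' k').val < (zig u' (k' + 1)).val) := ⟨_, rfl⟩
  have hmain : (∃ m, strandLift u m k = q) ∨
      ∃ m, strandLift u' m k' = if fwd' = fwd then q else q⁻¹ := by
    unfold strandLift
    rw [hkind, ← hfwd, ← hfwd']
    cases hK : kind u k
    · rw [hK] at hgood hgood'
      have h := (exists_gapLift_eq hgood' hgood fwd' fwd (if fwd then q else q⁻¹)).symm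
      revert h
      cases fwd <;> cases fwd' <;> simp
    · rw [hK] at hgood hgood'
      have h := exists_gapLift_eq hgood hgood' fwd fwd' (if fwd then q else q⁻¹)
      revert h
      cases fwd <;> cases fwd' <;> simp
  refine hmain.imp_right ?_
  rintro ⟨m, hm⟩
  have hlink := link_strandLift (u := u') hd hk' m
  rw [hm] at hlink
  rcases hij with ⟨h1, h2⟩ | ⟨h1, h2⟩
  · rw [h1, h2] at hlink hfwd'
    rwa [if_pos (hfwd'.trans hfwd.symm)] at hlink
  · rw [h1, h2] at hlink hfwd'
    have hopp : ¬ fwd' = fwd := by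
      rw [hfwd, hfwd', decide_eq_decide]
      omega
    rw [if_neg hopp] at hlink
    simpa using hlink.symm

theorem exists_link (hd : 3 ≤ d) {i j : ZMod d} (hij : i ≠ j) (q : Quat) :
    ∃ u, Link u i j q := by
  obtain ⟨u, k, hk, -, -, ⟨rfl, rfl⟩ | ⟨rfl, rfl⟩⟩ := exists_gap hd hij true
  · obtain ⟨u', -, h⟩ := exists_link_of_gap (u := u) hd hk
    rcases h q with ⟨m, rfl⟩ | h
    · exact ⟨u, link_strandLift hd hk m⟩
    · exact ⟨u', h⟩
  · obtain ⟨u', -, h⟩ := exists_link_of_gap (u := u) hd hk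
    rcases h q⁻¹ with ⟨m, hm⟩ | h
    · exact ⟨u, by simpa [hm] using (link_strandLift (u := u) hd hk m).symm⟩
    · exact ⟨u', by simpa using h.symm⟩

end Path

/-! ### The vertex set and the group action -/

open Zigzag Klein

/-- The vertices of the system: a fixed vertex and `d` copies of the quaternion group. -/
def QuatVertex (d : ℕ) : Type := Option (Quat × ZMod d)

namespace QuatVertex

variable {d : ℕ}

instance : DecidableEq (QuatVertex d) := inferInstanceAs (DecidableEq (Option (Quat × ZMod d)))

/-- The vertex with quaternion coordinate `g` in block `i`. -/
def mk (g : Quat) (i : ZMod d) : QuatVertex d := some (g, i)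

/-- The fixed vertex. -/
def infty : QuatVertex d := none

instance : MulAction Quat (QuatVertex d) where
  smul t v := Option.map (fun p => (t * p.1, p.2)) v
  one_smul v := by
    rcases v with _ | ⟨g, i⟩
    · rfl
    · exact congrArg (fun h => mk h i) (one_mul g)
  mul_smul t t' v := by
    rcases v with _ | ⟨g, i⟩
    · rfl
    · exact congrArg (fun h => mk h i) (mul_assoc t t' g)

theorem smul_mk (t g : Quat) (i : ZMod d) : t • mk g i = mk (t * g) i := rfl

theorem smul_infty (t : Quat) : t • (infty : QuatVertex d) = infty := rfl

instance : FaithfulSMul Quat (QuatVertex d) where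
  eq_of_smul_eq_smul {t t'} h := by
    have h1 := h (mk 1 0)
    rw [smul_mk, smul_mk, mul_one, mul_one] at h1
    exact (Prod.mk.injEq .. ▸ Option.some.inj h1).1

theorem cases (v : QuatVertex d) : v = infty ∨ ∃ g i, v = mk g i := by
  rcases v with _ | ⟨g, i⟩
  · exact Or.inl rfl
  · exact Or.inr ⟨g, i, rfl⟩

instance [NeZero d] : Fintype (QuatVertex d) := inferInstanceAs (Fintype (Option (Quat × ZMod d)))

theorem card [NeZero d] : Fintype.card (QuatVertex d) = 8 * d + 1 := by
  have h : Fintype.card (Option (Quat × ZMod d)) = 8 * d + 1 := by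
    rw [Fintype.card_option, Fintype.card_prod, ZMod.card, QuaternionGroup.card]
  exact h

end QuatVertex

open QuatVertex

/-! ### Base cycles and the covering of all edges -/

section Base

variable {d : ℕ} (u : ZMod d)

/-- The vertices of the path starting at `u`. -/
def pathVertex (n : ℕ) : QuatVertex d := mk (path u n) (zig u (blockIndex d n))

/-- The base cycle formed by the path starting at `u`, its image under the central involution and
the fixed vertex. -/
def baseCycle (k : ZMod (8 * d + 1)) : QuatVertex d :=
  if k.val = 0 then infty
  else if k.val ≤ 4 * d then pathVertex u (k.val - 1)
  else Quat.z • pathVertex u (8 * d - k.val)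

variable {u}

theorem baseCycle_zero : baseCycle u 0 = infty := by
  simp [baseCycle]

theorem baseCycle_natCast {n : ℕ} (hn : n < 4 * d) :
    baseCycle u ((n + 1 : ℕ) : ZMod (8 * d + 1)) = pathVertex u n := by
  rw [baseCycle, val_natCast_lt (by omega), if_neg (by omega), if_pos (by omega),
    Nat.add_sub_cancel]

theorem baseCycle_neg (k : ZMod (8 * d + 1)) : baseCycle u (-k) = Quat.z • baseCycle u k := by
  by_cases h0 : k = 0
  · subst h0
    rw [neg_zero, baseCycle_zero, smul_infty]
  · have hv0 : k.val ≠ 0 := fun h => h0 ((ZMod.val_eq_zero k).1 h)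
    have hlt := k.val_lt
    have hneg : (-k).val = 8 * d + 1 - k.val := by rw [ZMod.neg_val, if_neg h0]
    unfold baseCycle
    rw [hneg, if_neg (by omega), if_neg hv0]
    by_cases h : k.val ≤ 4 * d
    · rw [if_neg (by omega), if_pos h]
      congr 2
      omega
    · rw [if_pos (by omega), if_neg h, smul_smul, Quat.z_mul_z, one_smul]
      congr 1
      omega

theorem baseCycle_neg_natCast {n : ℕ} (hn : n < 4 * d) :
    baseCycle u (-((n + 1 : ℕ) : ZMod (8 * d + 1))) = Quat.z • pathVertex u n := by
  rw [baseCycle_neg, baseCycle_natCast hn]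

theorem exists_pathVertex (hd : 3 ≤ d) (u : ZMod d) (g : Quat) (i : ZMod d) :
    ∃ n < 4 * d, mk g i = pathVertex u n ∨ mk g i = Quat.z • pathVertex u n := by
  obtain ⟨k, hk, hki⟩ := exists_zig (by omega) u i
  obtain ⟨n, hn, hb, hp⟩ := exists_proj_path (u := u) hd hk (Quat.proj g)
  refine ⟨n, hn, ?_⟩
  rw [pathVertex, smul_mk, hb, hki, ← Quat.mul_z]
  rcases Quat.eq_or_eq_mul_z _ _ hp.symm with h | h
  · exact Or.inl (by rw [h])
  · exact Or.inr (by rw [h])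

theorem baseCycle_bijective (hd : 3 ≤ d) (u : ZMod d) : Function.Bijective (baseCycle u) := by
  have : NeZero d := ⟨by omega⟩
  rw [Fintype.bijective_iff_surjective_and_card]
  refine ⟨fun v => ?_, by rw [ZMod.card, QuatVertex.card]⟩
  rcases v.cases with rfl | ⟨g, i, rfl⟩
  · exact ⟨0, baseCycle_zero⟩
  · obtain ⟨n, hn, h | h⟩ := exists_pathVertex hd u g i
    · exact ⟨_, (baseCycle_natCast hn).trans h.symm⟩
    · exact ⟨_, (baseCycle_neg_natCast hn).trans h.symm⟩

/-- The edges of a translate of a base cycle. -/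
def translateEdges (t : Quat) (u : ZMod d) : Set (Sym2 (QuatVertex d)) :=
  cyclicEdges fun k => t • baseCycle u k

theorem mem_translateEdges (t : Quat) (u : ZMod d) {n : ℕ} (hn : n + 1 < 4 * d) :
    s(t • pathVertex u n, t • pathVertex u (n + 1)) ∈ translateEdges t u := by
  refine ⟨((n + 1 : ℕ) : ZMod (8 * d + 1)), ?_⟩
  have h : ((n + 1 : ℕ) : ZMod (8 * d + 1)) + 1 = ((n + 1 + 1 : ℕ) : ZMod (8 * d + 1)) := by
    push_cast
    rfl
  change s(t • baseCycle u _, t • baseCycle u (_ + 1)) = _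
  rw [h, baseCycle_natCast hn, baseCycle_natCast (by omega)]

/-- Right multiplication by z only reverses the cycle, since z reflects every base cycle. -/
theorem translateEdges_mul_z (t : Quat) (u : ZMod d) :
    translateEdges (t * Quat.z) u = translateEdges t u := by
  rw [translateEdges, translateEdges, ← cyclicEdges_comp_neg fun k => t • baseCycle u k]
  simp only [baseCycle_neg, smul_smul]

theorem translateEdges_eq_of_proj {t t' : Quat} (h : Quat.proj t = Quat.proj t') (u : ZMod d) :
    translateEdges t u = translateEdges t' u := by
  rcases Quat.eq_or_eq_mul_z _ _ h with rfl | rfl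
  · rfl
  · exact translateEdges_mul_z _ _

theorem exists_of_link {i j : ZMod d} {q : Quat} (h : Link u i j q) (g : Quat) :
    ∃ t, s(mk g i, mk (g * q) j) ∈ translateEdges t u := by
  obtain ⟨n, hn, ⟨rfl, rfl, h⟩ | ⟨rfl, rfl, h⟩⟩ := h
  · refine ⟨g * (path u n)⁻¹, ?_⟩
    have hm := mem_translateEdges (g * (path u n)⁻¹) u hn
    rw [pathVertex, pathVertex, h, smul_mk, smul_mk] at hm
    simpa [mul_assoc] using hm
  · refine ⟨g * (path u (n + 1))⁻¹, ?_⟩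
    have hm := mem_translateEdges (g * (path u (n + 1))⁻¹) u hn
    rw [pathVertex, pathVertex, smul_mk, smul_mk, Sym2.eq_swap] at hm
    have h' : path u n = path u (n + 1) * q := by rw [h]; simp
    rw [inv_mul_cancel_right] at hm
    rw [h'] at hm
    simpa [mul_assoc] using hm

theorem exists_infty_edge (hd : 3 ≤ d) (u : ZMod d) (g : Quat) :
    ∃ t, s(infty, mk g u) ∈ translateEdges t u := by
  refine ⟨g * (path u 0)⁻¹, 0, ?_⟩
  change s(_, _ • baseCycle u (0 + 1)) = _
  have h := baseCycle_natCast (u := u) (n := 0) (by omega)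
  simp only [zero_add, Nat.cast_one] at h ⊢
  rw [h, baseCycle_zero, smul_infty, pathVertex, smul_mk, inv_mul_cancel_right]
  simp [blockIndex, zig_zero]

theorem zig_blockIndex_zero (u : ZMod d) : zig u (blockIndex d 0) = u := by
  simp [blockIndex, zig_zero]

theorem zig_blockIndex_one (hd : 3 ≤ d) (u : ZMod d) : zig u (blockIndex d 1) = u := by
  rw [blockIndex, if_pos (by omega), Nat.sub_self, zig_zero]

theorem zig_blockIndex_two (hd : 3 ≤ d) (u : ZMod d) : zig u (blockIndex d 2) = zig u 1 := by
  rw [blockIndex, if_pos (by omega)]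

theorem zig_blockIndex_last (hd : 3 ≤ d) : zig u (blockIndex d (4 * d - 1)) = u := by
  rw [show blockIndex d (4 * d - 1) = 0 by unfold blockIndex; split_ifs <;> omega, zig_zero]

/-- This is the edge opposite ∞, where the path, ending in its starting block, meets its image under
z: positions 4d and 4d + 1 = -4d. -/
theorem involution_edge_mem (hd : 3 ≤ d) (u : ZMod d) (g : Quat) :
    s(mk g u, mk (g * Quat.z) u) ∈ translateEdges (g * (path u (4 * d - 1))⁻¹) u := by
  refine ⟨((4 * d - 1 + 1 : ℕ) : ZMod (8 * d + 1)), ?_⟩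
  have h : ((4 * d - 1 + 1 : ℕ) : ZMod (8 * d + 1)) + 1 =
      -((4 * d - 1 + 1 : ℕ) : ZMod (8 * d + 1)) := by
    rw [show 4 * d - 1 + 1 = 4 * d by omega, eq_neg_iff_add_eq_zero]
    have h0 := ZMod.natCast_self (8 * d + 1)
    push_cast at h0 ⊢
    linear_combination h0
  change s(_ • baseCycle u _, _ • baseCycle u (_ + 1)) = _
  rw [h, baseCycle_natCast (by omega), baseCycle_neg_natCast (by omega), pathVertex,
    zig_blockIndex_last hd, smul_mk, smul_mk, smul_mk, inv_mul_cancel_right, ← Quat.mul_z,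
    ← mul_assoc, inv_mul_cancel_right]

/-- Outside the centre q⁻¹ = q z, so one step read in both directions realises both lifts of its
difference. -/
theorem exists_of_pathStep {n : ℕ} (hn : n + 1 < 4 * d) {i : ZMod d}
    (hi : zig u (blockIndex d n) = i) (hi' : zig u (blockIndex d (n + 1)) = i) {q : Quat}
    (hq : Quat.proj q ≠ 0) (h : Quat.proj (pathStep u n) = Quat.proj q) (g : Quat) :
    ∃ t, s(mk g i, mk (g * q) i) ∈ translateEdges t u := by
  have hinv : ∀ q : Quat, Quat.proj q ≠ 0 → q⁻¹ = q * Quat.z := by decide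
  apply exists_of_link
  rcases Quat.eq_or_eq_mul_z _ _ h with h | h
  · exact ⟨n, hn, Or.inl ⟨hi, hi', by rw [path_succ, h]⟩⟩
  · exact ⟨n, hn, Or.inr ⟨hi, hi', by rw [path_succ, h, hinv q hq]⟩⟩

theorem exists_of_proj_eq_endColour (hd : 3 ≤ d) (u : ZMod d) {q : Quat}
    (hq : Quat.proj q = endColour u) (g : Quat) :
    ∃ t, s(mk g u, mk (g * q) u) ∈ translateEdges t u := by
  refine exists_of_pathStep (n := 0) (by omega) (zig_blockIndex_zero u)
    (zig_blockIndex_one hd u) (hq ▸ endColour_ne_zero u) ?_ g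
  rw [pathStep_zero, Quat.proj_lift, hq]

/-- Of the three nonzero differences inside block i, `endColour i` comes from the first step of the
path starting at i, and the other two from the turn of the path ending at i. -/
theorem exists_vertical_edge (hd : 3 ≤ d) (i : ZMod d) {q : Quat} (hq : Quat.proj q ≠ 0)
    (g : Quat) : ∃ t u, s(mk g i, mk (g * q) i) ∈ translateEdges t u := by
  by_cases hq' : Quat.proj q = endColour i
  · obtain ⟨t, ht⟩ := exists_of_proj_eq_endColour hd i hq' g
    exact ⟨t, i, ht⟩
  · obtain ⟨u, rfl⟩ := exists_last hd i
    have hb : ∀ n, d ≤ n → n ≤ d + 2 → zig u (blockIndex d n) = last u := by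
      intro n h1 h2
      rw [last]
      congr 1
      unfold blockIndex
      split_ifs <;> omega
    rcases last_vertical _ (sharedValue u) (endColour_ne_zero (last u)) _ hq hq' with h | h
    · obtain ⟨t, ht⟩ := exists_of_pathStep (n := d) (by omega) (hb _ (by omega) (by omega))
        (hb _ (by omega) (by omega)) hq
        (by rw [pathStep_turn hd, Quat.proj_lift, strand_last hd, turnValue, h]) g
      exact ⟨t, u, ht⟩
    · obtain ⟨t, ht⟩ := exists_of_pathStep (n := d + 1) (by omega) (hb _ (by omega) (by omega))
        (hb _ (by omega) (by omega)) hq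
        (by rw [pathStep_turn_succ hd, Quat.proj_lift, strand_last hd, turnValue, h]) g
      exact ⟨t, u, ht⟩

theorem exists_mem_translateEdges (hd : 3 ≤ d) (x y : QuatVertex d) (hxy : x ≠ y) :
    ∃ t u, s(x, y) ∈ translateEdges t u := by
  rcases x.cases with rfl | ⟨g, i, rfl⟩ <;> rcases y.cases with rfl | ⟨h, j, rfl⟩
  · exact absurd rfl hxy
  · obtain ⟨t, ht⟩ := exists_infty_edge hd j h
    exact ⟨t, j, ht⟩
  · obtain ⟨t, ht⟩ := exists_infty_edge hd i g
    exact ⟨t, i, Sym2.eq_swap ▸ ht⟩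
  · obtain ⟨q, rfl⟩ : ∃ q, h = g * q := ⟨g⁻¹ * h, by simp⟩
    by_cases hij : i = j
    · subst hij
      by_cases hq : Quat.proj q = 0
      · rcases Quat.eq_or_eq_mul_z q 1 (hq.trans Quat.proj_one.symm) with rfl | rfl
        · exact absurd (by rw [mul_one]) hxy
        · rw [one_mul]
          exact ⟨_, _, involution_edge_mem hd i g⟩
      · exact exists_vertical_edge hd i hq g
    · obtain ⟨u, hu⟩ := exists_link hd hij q
      obtain ⟨t, ht⟩ := exists_of_link hu g
      exact ⟨t, u, ht⟩

/-- By counting, the translates of the base cycles are edge-disjoint. -/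
theorem eq_of_mem_translateEdges (hd : 3 ≤ d) {t t' : Quat} {u u' : ZMod d}
    {e : Sym2 (QuatVertex d)} (he : e ∈ translateEdges t u) (he' : e ∈ translateEdges t' u') :
    u = u' ∧ translateEdges t u = translateEdges t' u' := by
  have : NeZero d := ⟨by omega⟩
  have : Fact (1 < 8 * d + 1) := ⟨by omega⟩
  have hnd : ∀ (b : Klein) (u : ZMod d) (k : ZMod (8 * d + 1)),
      ¬ s(b.lift • baseCycle u k, b.lift • baseCycle u (k + 1)).IsDiag := by
    intro b u k h
    rw [Sym2.mk_isDiag_iff] at h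
    have h1 := (baseCycle_bijective hd u).1 (MulAction.injective _ h)
    exact one_ne_zero (left_eq_add.1 h1)
  -- One representative per class modulo the centre, so that domain and codomain both have 4d(8d +
  -- 1) elements and surjectivity gives injectivity.
  let Φ : Klein × ZMod d × ZMod (8 * d + 1) → {e : Sym2 (QuatVertex d) // ¬ e.IsDiag} :=
    fun p => ⟨_, hnd p.1 p.2.1 p.2.2⟩
  have hnorm : ∀ t u (e : {e : Sym2 (QuatVertex d) // ¬ e.IsDiag}), e.1 ∈ translateEdges t u →
      ∃ k, Φ (Quat.proj t, u, k) = e := by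
    intro t u e h
    rw [translateEdges_eq_of_proj (Quat.proj_lift (Quat.proj t)).symm] at h
    obtain ⟨k, hk⟩ := h
    exact ⟨k, Subtype.ext hk⟩
  have hsurj : Function.Surjective Φ := by
    rintro ⟨e, he⟩
    induction e using Sym2.ind with
    | _ x y =>
      obtain ⟨t, u, h⟩ := exists_mem_translateEdges hd x y (by simpa using he)
      obtain ⟨k, hk⟩ := hnorm t u ⟨s(x, y), he⟩ h
      exact ⟨_, hk⟩
  have hcard : Fintype.card (Klein × ZMod d × ZMod (8 * d + 1)) =
      Fintype.card {e : Sym2 (QuatVertex d) // ¬ e.IsDiag} := by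
    rw [Sym2.card_subtype_not_diag, QuatVertex.card, Fintype.card_prod Klein, Fintype.card_prod (ZMod d),
      ZMod.card, ZMod.card, Nat.choose_two_right, Nat.add_sub_cancel,
      show (8 * d + 1) * (8 * d) = 4 * (d * (8 * d + 1)) * 2 by ring,
      Nat.mul_div_cancel _ (by norm_num)]
    rfl
  have hinj := ((Fintype.bijective_iff_surjective_and_card Φ).2 ⟨hsurj, hcard⟩).1
  have hne : ¬ e.IsDiag := by
    obtain ⟨k, rfl⟩ := he
    change ¬ s(_, _).IsDiag
    rw [Sym2.mk_isDiag_iff]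
    intro h
    have h1 := (baseCycle_bijective hd u).1 (MulAction.injective t h)
    exact one_ne_zero (left_eq_add.1 h1)
  obtain ⟨k, hk⟩ := hnorm t u ⟨e, hne⟩ he
  obtain ⟨k', hk'⟩ := hnorm t' u' ⟨e, hne⟩ he'
  have h := hinj (hk.trans hk'.symm)
  simp only [Prod.mk.injEq] at h
  obtain ⟨h1, rfl, -⟩ := h
  exact ⟨rfl, translateEdges_eq_of_proj h1 u⟩

/-- The base cycles of the system. -/
def quatStarter (hd : 3 ≤ d) : CycleStarter Quat (QuatVertex d) (ZMod d) (8 * d + 1) where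
  base := baseCycle
  infty := infty
  z := Quat.z
  base_bijective := baseCycle_bijective hd
  base_zero _ := baseCycle_zero
  smul_infty := smul_infty
  mul_z := Quat.mul_z
  base_neg _ k := baseCycle_neg k
  exists_mem := exists_mem_translateEdges hd
  eq_of_mem _ _ _ _ _ := eq_of_mem_translateEdges hd

/-! ### Edge patterns that restrict the automorphisms -/

theorem path_one_mul_strandLift (hd : 3 ≤ d) (u : ZMod d) :
    path u 2 = path u 1 * strandLift u 0 0 := by
  rw [path_succ, ← pathStep_strand_zero (by omega)]

theorem involution_edge_mem_start (hd : 3 ≤ d) (u : ZMod d) :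
    s(baseCycle u 1, baseCycle u (-1)) ∈
      translateEdges (path u 0 * (path u (4 * d - 1))⁻¹) u := by
  have h1 := baseCycle_natCast (u := u) (n := 0) (by omega)
  have h2 := baseCycle_neg_natCast (u := u) (n := 0) (by omega)
  simp only [zero_add, Nat.cast_one] at h1 h2
  rw [h1, h2, pathVertex, zig_blockIndex_zero, smul_mk, ← Quat.mul_z]
  exact involution_edge_mem hd u _

/-- Position -3 is the image under z of position 3, so this edge has the quotient of strand 0 in the
first gap multiplied by z: the second lift of the same difference. -/
theorem second_edge_eq (hd : 3 ≤ d) (u : ZMod d) : s(baseCycle u 2, baseCycle u (-3)) =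
    s(mk (path u 1) (zig u 0), mk (path u 1 * (strandLift u 0 0 * Quat.z)) (zig u 1)) := by
  have h1 := baseCycle_natCast (u := u) (n := 1) (by omega)
  have h2 := baseCycle_neg_natCast (u := u) (n := 2) (by omega)
  norm_num at h1 h2
  rw [h1, h2, pathVertex, pathVertex, zig_blockIndex_one hd, zig_blockIndex_two hd, smul_mk,
    ← Quat.mul_z, path_one_mul_strandLift hd, zig_zero, mul_assoc]

/-- In path 0 strand 1 or 2 repeats the first difference of strand 0 and receives its other lift, so
the second edge lies in a translate of base cycle 0. -/
theorem sameCycle_start (hd : 3 ≤ d) : (quatStarter hd).SameCycle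
    s(baseCycle (0 : ZMod d) 1, baseCycle 0 (-1)) s(baseCycle (0 : ZMod d) 2, baseCycle 0 (-3)) := by
  refine ⟨_, _, involution_edge_mem_start hd 0, ?_⟩
  change _ ∈ translateEdges _ _
  obtain ⟨m, hm, hdiff⟩ := first_special (decide ((d - 2) % 2 = 0)) (kind (0 : ZMod d) 0)
    (endColour (0 : ZMod d)) (startColour (0 : ZMod d)) (endColour (last (0 : ZMod d))) (endColour_ne_zero _)
    (startColour_ne_zero _) (endColour_ne_startColour hd _)
  have hgap : gapDiff (0 : ZMod d) 0 m = gapDiff (0 : ZMod d) 0 0 := by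
    rw [gapDiff, gapDiff, zero_add, strand_zero, strand_zero, strand_one hd, strand_one hd,
      innerBlock, decide_eq_true (rfl : (0 : ZMod d) = 0), hdiff]
  have hlift : strandLift (0 : ZMod d) m 0 = strandLift (0 : ZMod d) 0 0 * Quat.z := by
    rw [strandLift, strandLift, gapLift_of_lt (m' := 0) (by rcases hm with rfl | rfl <;> decide)
      hgap.symm, gapLift_of_first (m := 0) (by intro m' h; exact absurd h (by simp)), hgap]
  have hproj : Quat.proj (path (0 : ZMod d) (2 * d + 1)) = 0 := by
    have h := proj_path_strand_two (u := (0 : ZMod d)) hd (k := 0) (by omega)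
    rw [add_zero, strand_zero] at h
    exact h
  -- The values in the first block satisfy y + x = (x + y) + 0, so the translates containing the two
  -- edges agree modulo the centre.
  have ht : Quat.proj (path (0 : ZMod d) 0 * (path (0 : ZMod d) (4 * d - 1))⁻¹) =
      Quat.proj (path (0 : ZMod d) 1 * (path (0 : ZMod d) (2 * d + 1))⁻¹) := by
    have h1 := proj_path_strand_zero (u := (0 : ZMod d)) (k := 0) (by omega)
    have h2 := proj_path_strand_three (u := (0 : ZMod d)) hd (k := 0) (by omega)
    rw [Nat.sub_zero] at h2
    rw [zero_add] at h1
    rw [Quat.proj_mul, Quat.proj_mul, Quat.proj_inv, Quat.proj_inv, hproj, h1, h2,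
      proj_path_zero, strand_zero, strand_zero]
    simp [firstBlock, add_comm]
  rw [translateEdges_eq_of_proj ht, second_edge_eq hd, ← hlift]
  rcases hm with rfl | rfl
  · have h := mem_translateEdges (path (0 : ZMod d) 1 * (path (0 : ZMod d) (2 * d + 1))⁻¹)
      (0 : ZMod d) (n := 2 * d) (by omega)
    have hs := pathStep_strand_one (u := (0 : ZMod d)) hd (k := 0) (by omega)
    rw [Nat.sub_zero] at hs
    have hp : path (0 : ZMod d) (2 * d) =
        path (0 : ZMod d) (2 * d + 1) * strandLift (0 : ZMod d) 1 0 := by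
      rw [path_succ, hs, inv_mul_cancel_right]
    rw [pathVertex, pathVertex, smul_mk, smul_mk, inv_mul_cancel_right, hp, Sym2.eq_swap,
      ← mul_assoc, inv_mul_cancel_right] at h
    have hb : blockIndex d (2 * d) = 1 := by unfold blockIndex; split_ifs <;> omega
    have hb' : blockIndex d (2 * d + 1) = 0 := by unfold blockIndex; split_ifs <;> omega
    rwa [hb, hb'] at h
  · have h := mem_translateEdges (path (0 : ZMod d) 1 * (path (0 : ZMod d) (2 * d + 1))⁻¹)
      (0 : ZMod d) (n := 2 * d + 1) (by omega)
    have hs := pathStep_strand_two (u := (0 : ZMod d)) hd (k := 0) (by omega)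
    rw [add_zero] at hs
    rw [pathVertex, pathVertex, smul_mk, smul_mk, inv_mul_cancel_right, path_succ (2 * d + 1), hs,
      ← mul_assoc, inv_mul_cancel_right] at h
    have hb : blockIndex d (2 * d + 1 + 1) = 1 := by unfold blockIndex; split_ifs <;> omega
    have hb' : blockIndex d (2 * d + 1) = 0 := by unfold blockIndex; split_ifs <;> omega
    rwa [hb, hb'] at h

/-- The first edge forces a translate of base cycle u. The second lift of the unrepeated difference
of strand 0 is realised by another path over the same two blocks. -/
theorem not_sameCycle_start (hd : 3 ≤ d) {u : ZMod d} (hu : u ≠ 0) : ¬ (quatStarter hd).SameCycle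
    s(baseCycle u 1, baseCycle u (-1)) s(baseCycle u 2, baseCycle u (-3)) := by
  rintro ⟨t, u₁, h1, h2⟩
  obtain ⟨rfl, -⟩ := eq_of_mem_translateEdges hd (involution_edge_mem_start hd u) h1
  obtain ⟨u', huu, hlink⟩ := exists_link_of_gap (u := u) hd (k := 0) (by omega)
  rcases hlink (strandLift u 0 0 * Quat.z) with ⟨m, hm⟩ | hlink
  · have hgap : gapDiff u 0 m = gapDiff u 0 0 := by
      have h := congrArg Quat.proj hm
      rw [Quat.proj_mul, Quat.proj_z, add_zero, strandLift, strandLift, proj_gapLift,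
        proj_gapLift] at h
      exact h
    obtain rfl : m = 0 := by
      refine first_not_special (decide ((d - 2) % 2 = 0)) (kind u 0) _ _
        (endColour (last u)) (endColour_ne_zero u) (startColour_ne_zero u)
        (endColour_ne_startColour hd u) m ?_
      rw [gapDiff, gapDiff, zero_add, strand_zero, strand_zero, strand_one hd, strand_one hd,
        innerBlock, decide_eq_false hu] at hgap
      exact hgap
    exact absurd (left_eq_mul.1 hm) (by decide)
  · obtain ⟨t', ht'⟩ := exists_of_link hlink (path u 1)
    rw [second_edge_eq hd] at h2
    exact huu (eq_of_mem_translateEdges hd ht' h2).1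

/-- The neighbours of the turning vertex have difference `endColour (last u)`, so they are joined in
a translate of base cycle `last u`, whereas the neighbours of ∞ are joined in one of base cycle u.
-/
theorem not_sameCycle_turn (hd : 3 ≤ d) (u : ZMod d) : ¬ (quatStarter hd).SameCycle
    s(baseCycle u (-1), baseCycle u 1)
    s(baseCycle u ((d + 2 : ℕ) - 1), baseCycle u ((d + 2 : ℕ) + 1)) := by
  rintro ⟨t, u₁, h1, h2⟩
  rw [Sym2.eq_swap] at h1
  obtain ⟨rfl, -⟩ := eq_of_mem_translateEdges hd (involution_edge_mem_start hd u) h1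
  have e1 : (((d + 2 : ℕ) : ZMod (8 * d + 1)) - 1) = ((d + 1 : ℕ) : ZMod (8 * d + 1)) := by
    push_cast
    ring
  have e2 : (((d + 2 : ℕ) : ZMod (8 * d + 1)) + 1) = ((d + 2 + 1 : ℕ) : ZMod (8 * d + 1)) := by
    push_cast
    rfl
  have hb : ∀ n, d ≤ n → n ≤ d + 2 → zig u (blockIndex d n) = last u := by
    intro n h1 h2
    rw [last]
    congr 1
    unfold blockIndex
    split_ifs <;> omega
  rw [e1, e2, baseCycle_natCast (by omega), baseCycle_natCast (by omega), pathVertex, pathVertex,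
    hb _ (by omega) (by omega), hb _ (by omega) (by omega)] at h2
  obtain ⟨q, hq⟩ : ∃ q, path u (d + 2) = path u d * q := ⟨(path u d)⁻¹ * path u (d + 2), by simp⟩
  have hproj : Quat.proj q = endColour (last u) := by
    have h3 := proj_path_strand_zero (u := u) (k := d - 1) (by omega)
    have h4 := proj_path_strand_one (u := u) hd (k := d - 1) (by omega)
    rw [show d - 1 + 1 = d by omega] at h3
    rw [show 2 * d + 1 - (d - 1) = d + 2 by omega, hq, Quat.proj_mul, h3, strand_last hd,
      strand_last hd] at h4
    exact add_left_cancel h4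
  rw [hq] at h2
  obtain ⟨t', ht'⟩ := exists_of_proj_eq_endColour hd (last u) hproj (path u d)
  exact last_ne hd u (eq_of_mem_translateEdges hd ht' h2).1

end Base

/-! ### The theorem -/

theorem theorem5 (d : ℕ) (hd : 3 ≤ d) :
    ∃ 𝓗 : HamCycleSystem (Fin (8 * d + 1)), Nonempty (𝓗.autGroup ≃* QuaternionGroup 2) := by
  have : NeZero d := ⟨by omega⟩
  obtain ⟨f⟩ := (quatStarter hd).nonempty_autGroup_mulEquiv (by omega) ⟨4 * d, by ring⟩ 0
    (fun u => ⟨fun h => by_contra fun hu => not_sameCycle_start hd hu h,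
      fun h => h ▸ sameCycle_start hd⟩)
    ⟨0, _, not_sameCycle_turn hd 0⟩
  let e : QuatVertex d ≃ Fin (8 * d + 1) := Fintype.equivFinOfCardEq QuatVertex.card
  obtain ⟨g⟩ := ((quatStarter hd).system (by omega)).nonempty_autGroup_map e
  exact ⟨_, ⟨g.trans f⟩⟩
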